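/- A Stirling permutation of order $n$ is a rearrangement $\sigma$ of the multiset $\{1^2,2^2,\dots,n^2\}$ in which every letter between the two occurrences of $i$ is greater than $i$, for each $i$; $\mathcal{Q}_n$ denotes the set of these ($\mathcal{Q}_0$ consists of the empty word). The block $[i,i]_\sigma$ is the segment of $\sigma$ from the first to the second occurrence of $i$, inclusive. It is a level $1$ block if it is contained in no other block; for $\ell\ge 2$ it is a level $\ell$ block if it is contained in a level $\ell-1$ block $[j,j]_\sigma$ (its parent), $j\neq i$, and is a level $1$ block of the word strictly between the two occurrences of $j$. Two blocks are siblings if both are of level $1$ or they have the same parent. Let $\mathrm{bl}^{(\ell)}(\sigma)$ be the number of level $\ell$ blocks of $\sigma$. A pattern $p$ is a permutation $p_1\cdots p_m$ of $\{1,\dots,m\}$, $m\ge 1$, in which some consecutive entries may be connected by underlines; we also allow the symbol $\emptyset$, a pattern that never occurs. An occurrence of $p$ in a permutation $\pi$ is a choice of positions $i_1<\dots<i_m$ such that $\pi_{i_1}\cdots\pi_{i_m}$ is order isomorphic to $p_1\cdots p_m$ and $i_{j+1}=i_j+1$ whenever $p_j$ and $p_{j+1}$ are connected by an underline; $p(\pi)$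 is the number of occurrences. An occurrence of $p$ in $\sigma\in\mathcal{Q}_n$ at level $\ell$ is a sequence of pairwise sibling level $\ell$ blocks $[b_1,b_1]_\sigma,\dots,[b_m,b_m]_\sigma$, appearing from left to right in $\sigma$, such that $b_1\cdots b_m$ is order isomorphic to $p_1\cdots p_m$ and, whenever $p_j$ and $p_{j+1}$ are connected by an underline, the second occurrence of $b_j$ is immediately followed by the first occurrence of $b_{j+1}$; $p^{(\ell)}(\sigma)$ is the number of such occurrences. For a set $A$ of patterns, a pattern $p$ and $n\ge 0$ put $$f_n^{A,p}(z)=\sum_{\pi} z^{p(\pi)},$$ the sum being over all permutations $\pi$ of $\{1,\dots,n\}$ with $a(\pi)=0$ for all $a\in A$. For a sequence $\mathbf{A}=(A_1,A_2,\dots)$ of sets of patterns, a sequence $\mathbf{p}=(p_1,p_2,\dots)$ of patterns, and sequences of variables $\mathbf{x}=(x_1,x_2,\dots)$, $\mathbf{y}=(y_1,y_2,\dots)$, put $$g_n^{\mathbf{A},\mathbf{p}}(\mathbf{x};\mathbf{y})=\sum_{\sigma}\prod_{i\ge 1}x_i^{p_i^{(i)}(\sigma)}\,y_i^{\mathrm{bl}^{(i)}(\sigma)},$$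 the sum being over all $\sigma\in\mathcal{Q}_n$ with $a^{(i)}(\sigma)=0$ for all $i\ge 1$ and all $a\in A_i$. In particular $f_0^{A,p}=g_0^{\mathbf{A},\mathbf{p}}=1$. Write $\mathrm{sh}(s_1,s_2,s_3,\dots)=(s_2,s_3,\dots)$. Then for every $n\ge 0$ $$g_n^{\mathbf{A},\mathbf{p}}(\mathbf{x};\mathbf{y})=\sum_{\lambda\vdash n}\binom{n}{\lambda}\,\frac{y_1^{\ell(\lambda)}\,f_{\ell(\lambda)}^{A_1,p_1}(x_1)}{m_1(\lambda)!\cdots m_n(\lambda)!}\prod_{i=1}^{\ell(\lambda)}g_{\lambda_i-1}^{\mathrm{sh}(\mathbf{A}),\mathrm{sh}(\mathbf{p})}(\mathrm{sh}(\mathbf{x});\mathrm{sh}(\mathbf{y})),$$ where $\lambda=(\lambda_1,\dots,\lambda_{\ell(\lambda)})$ runs over the integer partitions of $n$, $\ell(\lambda)$ is the number of parts of $\lambda$, $m_i(\lambda)$ is the number of parts equal to $i$, and $\binom{n}{\lambda}=\frac{n!}{\lambda_1!\cdots\lambda_{\ell(\lambda)}!}$. The identity holds for all values of the variables in a commutative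 $\mathbb{Q}$-algebra, in particular as an identity of polynomials. -/

import Mathlib

namespace BlockPattern

/-! Words are lists of natural numbers; positions in a word are counted from `0`. -/

/-- Position of the first occurrence of `i` in `w` (meaningful when `i ∈ w`). -/
def firstPos (w : List ℕ) (i : ℕ) : ℕ := w.idxOf i

/-- Position of the last occurrence of `i` in `w` (meaningful when `i ∈ w`). -/
def lastPos (w : List ℕ) (i : ℕ) : ℕ := w.length - 1 - w.reverse.idxOf i

/-- The word `(i,i)_w` strictly between the first and the last occurrence of `i` in `w`. -/
def inner (w : List ℕ) (i : ℕ) : List ℕ := (w.take (lastPos w i)).drop (firstPos w i + 1)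

/-- Between any two occurrences of `i`, every letter (other than `i`) is greater than `i`;
stated for words in which no letter occurs more than twice. -/
def IsStirlingWord (w : List ℕ) : Prop :=
  ∀ a b c i j : ℕ, a < b → b < c →
    w[a]? = some i → w[c]? = some i → w[b]? = some j → i < j

open Classical in
/-- The finite set `Q_n` of Stirling permutations of order `n`: rearrangements of the multiset
`{1,1,2,2,…,n,n}` in which all letters between the two occurrences of `i` exceed `i`. -/
noncomputable def stirlingPerms (n : ℕ) : Finset (List ℕ) :=
  (2 • (Finset.Icc 1 n).val).lists.toFinset.filter IsStirlingWord

/-- `[i,i]_w ⊂ [j,j]_w`: the letters differ, and the segment of `w` from the first to the last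
occurrence of `i` lies inside the segment from the first to the last occurrence of `j`. -/
def BlockSub (w : List ℕ) (i j : ℕ) : Prop :=
  i ≠ j ∧ firstPos w j ≤ firstPos w i ∧ lastPos w i ≤ lastPos w j

/-- `[i,i]_w` is a level 1 block of `w`. -/
def IsLevelOne (w : List ℕ) (i : ℕ) : Prop :=
  i ∈ w ∧ ∀ j ∈ w, ¬ BlockSub w i j

/-- `IsLevel w l i`: `[i,i]_w` is a level `l` block of `w` (there are no blocks of level `0`). -/
def IsLevel (w : List ℕ) : ℕ → ℕ → Prop
  | 0, _ => False
  | 1, i => IsLevelOne w i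
  | l + 2, i => ∃ j, IsLevel w (l + 1) j ∧ BlockSub w i j ∧ IsLevelOne (inner w j) i

/-- `[j,j]_w` is the parent of the block `[i,i]_w`. -/
def IsParent (w : List ℕ) (j i : ℕ) : Prop :=
  BlockSub w i j ∧ ∃ l, IsLevel w (l + 1) i ∧ IsLevel w l j

/-- The blocks `[i,i]_w` and `[j,j]_w` are siblings. -/
def AreSiblings (w : List ℕ) (i j : ℕ) : Prop :=
  (IsLevel w 1 i ∧ IsLevel w 1 j) ∨ ∃ k, IsParent w k i ∧ IsParent w k j

/-- `bl^{(l)}(w)`: the number of level `l` blocks of `w`. -/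
noncomputable def blockCount (w : List ℕ) (l : ℕ) : ℕ := {i | IsLevel w l i}.ncard

/-- A permutation pattern: a permutation of length `len`, some of whose consecutive entries are
underlined. With entries numbered from `0`, `j ∈ underline` says that entries `j` and `j + 1`
are connected by an underline. The pattern of length `0` is the symbol `∅`, "no pattern". -/
structure PermPattern where
  len : ℕ
  perm : Equiv.Perm (Fin len)
  underline : Set ℕ
  underline_lt : ∀ j ∈ underline, j + 1 < len

/-- The word `u`, of the length of `p`, is order isomorphic to the permutation of `p`. -/
def PermPattern.Matches (p : PermPattern) {α : Type*} [LinearOrder α] (u : Fin p.len → α) : Prop :=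
  ∀ s t : Fin p.len, u s < u t ↔ p.perm s < p.perm t

/-- The occurrences (as tuples of positions) of the pattern `p` in the word `w`.
The pattern `∅` never occurs. -/
def PermPattern.occurrences (p : PermPattern) {n : ℕ} {α : Type*} [LinearOrder α]
    (w : Fin n → α) : Set (Fin p.len → Fin n) :=
  {i | 0 < p.len ∧ StrictMono i ∧ p.Matches (fun s => w (i s)) ∧
    ∀ s t : Fin p.len, (s : ℕ) ∈ p.underline → (t : ℕ) = s + 1 → (i t : ℕ) = i s + 1}

/-- `p(π)`: the number of occurrences of `p` in the permutation `π`. -/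
noncomputable def PermPattern.count (p : PermPattern) {n : ℕ} (π : Equiv.Perm (Fin n)) : ℕ :=
  (p.occurrences (fun k => π k)).ncard

/-- The occurrences (as tuples of letters `b_1, …, b_m`) of `p` as a block pattern at level `l`
in `σ`. The pattern `∅` never occurs. -/
def PermPattern.blockOccurrences (p : PermPattern) (σ : List ℕ) (l : ℕ) : Set (Fin p.len → ℕ) :=
  {b | 0 < p.len ∧ (∀ s, IsLevel σ l (b s)) ∧ (∀ s t, AreSiblings σ (b s) (b t)) ∧
    StrictMono (fun s => firstPos σ (b s)) ∧ p.Matches b ∧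
    ∀ s t : Fin p.len, (s : ℕ) ∈ p.underline → (t : ℕ) = s + 1 →
      firstPos σ (b t) = lastPos σ (b s) + 1}

/-- `p^{(l)}(σ)`: the number of occurrences of `p` as a block pattern at level `l` in `σ`. -/
noncomputable def PermPattern.levelCount (p : PermPattern) (σ : List ℕ) (l : ℕ) : ℕ :=
  (p.blockOccurrences σ l).ncard

open Classical in
/-- `f_n^{A,p}(z)`: the sum of `z ^ p(π)` over the permutations `π` of length `n` avoiding `A`. -/
noncomputable def fCoeff {R : Type*} [CommRing R] (A : Set PermPattern) (p : PermPattern)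
    (n : ℕ) (z : R) : R :=
  ∑ π ∈ (Finset.univ : Finset (Equiv.Perm (Fin n))).filter (fun π => ∀ a ∈ A, a.count π = 0),
    z ^ p.count π

/-! A sequence `(s_1, s_2, …)` is a function `s` on `ℕ` with `s i` standing for `s_{i+1}`. -/

/-- `sh(s) = (s_2, s_3, …)`. -/
def shift {α : Type*} (s : ℕ → α) : ℕ → α := fun i => s (i + 1)

open Classical in
/-- `Q_n(A)`: the Stirling permutations of order `n` avoiding, for every `i ≥ 1`, all patterns
of `A_i` at level `i`. -/
noncomputable def stirlingAvoiding (A : ℕ → Set PermPattern) (n : ℕ) : Finset (List ℕ) :=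
  (stirlingPerms n).filter (fun σ => ∀ i, ∀ a ∈ A i, a.levelCount σ (i + 1) = 0)

/-- `g_n^{A,p}(x; y)`. For each `σ` only finitely many factors of the product differ from `1`,
as `σ` has only finitely many blocks. -/
noncomputable def gCoeff {R : Type*} [CommRing R] (A : ℕ → Set PermPattern) (p : ℕ → PermPattern)
    (n : ℕ) (x y : ℕ → R) : R :=
  ∑ σ ∈ stirlingAvoiding A n,
    ∏ᶠ i : ℕ, x i ^ (p i).levelCount σ (i + 1) * y i ^ blockCount σ (i + 1)

end BlockPattern

namespace BlockPattern

/-! ### Segments of words -/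

section Segment
variable {pre w post : List ℕ} {i j : ℕ}

/-! A Stirling permutation is, in exactly one way, a concatenation of blocks `b w b` with pairwise
disjoint letter sets, where `w` is again a Stirling permutation and `b` is smaller than all its
letters (`IsStirlingPerm.exists_isBlockList`, `assemble_injective`). Hence Stirling permutations
correspond to ordered set partitions `T` with a Stirling permutation of each part minus its minimum
(`sum_stirlingOn`).

These blocks are the level 1 blocks, so level 1 statistics see only the relative order of the
minima, while a statistic at a deeper level is the sum over the blocks of the statistic one level
higher up in their interiors. The weight therefore factors (`wordWeight_assemble`), and increasing
relabelling turns the sum over each interior into a `gCoeff` of index `|T j| - 1`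
(`sum_wordWeight_stirlingOn`).

The product over the interiors does not depend on the order of the parts. Averaging over the `k!`
orders replaces the weight of the minima by `fCoeff` divided by `k!` (`sum_orderWeight_mul`). What
remains is the sum of a multiplicative weight over ordered set partitions, which is `n! k!` times a
sum over integer partitions with `k` parts (`orderedSum_eq`): both sides obey the same recursion in
`k`. The two `k!` cancel. -/

theorem firstPos_lt (h : i ∈ w) : firstPos w i < w.length := List.idxOf_lt_length_of_mem h

theorem lastPos_lt (h : i ∈ w) : lastPos w i < w.length := by
  have := List.length_pos_of_mem h
  unfold lastPos; omega

theorem firstPos_inj (hi : i ∈ w) (h : firstPos w i = firstPos w j) : i = j :=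
  List.idxOf_inj hi |>.1 h

theorem firstPos_segment (h : i ∈ w) (hpre : i ∉ pre) :
    firstPos (pre ++ w ++ post) i = pre.length + firstPos w i := by
  unfold firstPos
  rw [List.append_assoc, List.idxOf_append_of_notMem hpre, List.idxOf_append_of_mem h]

theorem lastPos_segment (h : i ∈ w) (hpost : i ∉ post) :
    lastPos (pre ++ w ++ post) i = pre.length + lastPos w i := by
  unfold lastPos
  have h' : i ∈ w.reverse := by simpa
  have hlt := List.idxOf_lt_length_of_mem h'
  rw [List.reverse_append, List.reverse_append, List.idxOf_append_of_notMem (by simpa),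
    List.idxOf_append_of_mem h']
  simp only [List.length_append, List.length_reverse] at *
  omega

theorem inner_segment (h : i ∈ w) (hpre : i ∉ pre) (hpost : i ∉ post) :
    inner (pre ++ w ++ post) i = inner w i := by
  have := lastPos_lt h
  unfold inner
  rw [firstPos_segment h hpre, lastPos_segment h hpost, List.append_assoc,
    List.take_append,
    List.take_of_length_le (by omega), Nat.add_sub_cancel_left,
    List.take_append_of_le_length (by omega), add_assoc, List.drop_append,
    List.drop_of_length_le (by omega), Nat.add_sub_cancel_left, List.nil_append]

theorem inner_subset : inner w i ⊆ w :=
  fun _ h => List.mem_of_mem_take (List.mem_of_mem_drop h)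

theorem IsLevel.mem {l : ℕ} (h : IsLevel w l i) : i ∈ w := by
  match l with
  | 0 => exact h.elim
  | 1 => exact h.1
  | l + 2 => obtain ⟨j, _, _, h⟩ := h; exact inner_subset h.1

/-- Along a chain of nested blocks the first positions strictly increase. This bounds the depth of a
word by its length, so that only finitely many levels contribute to the weight. -/
theorem IsLevel.le_firstPos {l : ℕ} (h : IsLevel w l i) : l ≤ firstPos w i + 1 := by
  induction l generalizing i with
  | zero => omega
  | succ l ih =>
    cases l with
    | zero => omega
    | succ l =>
      obtain ⟨j, hj, hs, -⟩ := h
      have h1 := ih hj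
      have : firstPos w j ≠ firstPos w i := fun e => hs.1 (firstPos_inj hj.mem e).symm
      have := hs.2.1
      omega

theorem IsLevel.le_length {l : ℕ} (h : IsLevel w l i) : l ≤ w.length :=
  h.le_firstPos.trans (firstPos_lt h.mem)

end Segment

/-! ### Words assembled from blocks -/

/-- The block `b w b`. -/
def blockWord (B : ℕ × List ℕ) : List ℕ := B.1 :: (B.2 ++ [B.1])

/-- The concatenation of a list of blocks. -/
def assemble (L : List (ℕ × List ℕ)) : List ℕ := L.flatMap blockWord

/-- The outer letter of a block does not occur inside it, and blocks share no letters. -/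
def Separated (L : List (ℕ × List ℕ)) : Prop :=
  (∀ B ∈ L, B.1 ∉ B.2) ∧ L.Pairwise fun B C => (blockWord B).Disjoint (blockWord C)

theorem mem_blockWord {B : ℕ × List ℕ} {i : ℕ} : i ∈ blockWord B ↔ i = B.1 ∨ i ∈ B.2 := by
  simp only [blockWord, List.mem_cons, List.mem_append, List.not_mem_nil, or_false]
  tauto

theorem mem_assemble {L : List (ℕ × List ℕ)} {i : ℕ} :
    i ∈ assemble L ↔ ∃ B ∈ L, i ∈ blockWord B := List.mem_flatMap

@[simp] theorem length_blockWord (B : ℕ × List ℕ) : (blockWord B).length = B.2.length + 2 := by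
  simp [blockWord]

theorem firstPos_blockWord (B : ℕ × List ℕ) : firstPos (blockWord B) B.1 = 0 := by
  simp [firstPos, blockWord]

theorem lastPos_blockWord (B : ℕ × List ℕ) : lastPos (blockWord B) B.1 = B.2.length + 1 := by
  simp [lastPos, blockWord]

theorem inner_blockWord (B : ℕ × List ℕ) : inner (blockWord B) B.1 = B.2 := by
  rw [inner, firstPos_blockWord, lastPos_blockWord]
  simp [blockWord]

/-- The position at which the `m`-th block starts. -/
def startPos (L : List (ℕ × List ℕ)) (m : ℕ) : ℕ := (assemble (L.take m)).length

theorem startPos_succ {L : List (ℕ × List ℕ)} {m : ℕ} (hm : m < L.length) :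
    startPos L (m + 1) = startPos L m + (L[m].2.length + 2) := by
  rw [startPos, startPos, List.take_add_one, List.getElem?_eq_getElem hm, assemble,
    List.flatMap_append]
  simp [assemble]

theorem startPos_mono (L : List (ℕ × List ℕ)) : Monotone (startPos L) := by
  refine monotone_nat_of_le_succ fun m => ?_
  by_cases hm : m < L.length
  · rw [startPos_succ hm]; omega
  · rw [startPos, startPos, List.take_of_length_le (by omega), List.take_of_length_le (by omega)]

theorem assemble_split (L : List (ℕ × List ℕ)) {m : ℕ} (hm : m < L.length) :
    assemble L = assemble (L.take m) ++ blockWord L[m] ++ assemble (L.drop (m + 1)) := by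
  conv_lhs => rw [← List.take_append_drop m L, List.drop_eq_getElem_cons hm]
  simp only [assemble, List.flatMap_append, List.flatMap_cons, List.append_assoc]

namespace Separated
variable {L : List (ℕ × List ℕ)} (h : Separated L) {i j m : ℕ}
include h

theorem index_eq {a b : ℕ} (ha : a < L.length) (hb : b < L.length)
    (hia : i ∈ blockWord L[a]) (hib : i ∈ blockWord L[b]) : a = b := by
  by_contra hne
  rcases Nat.lt_or_gt_of_ne hne with hlt | hlt
  · exact List.pairwise_iff_getElem.1 h.2 a b ha hb hlt hia hib
  · exact List.pairwise_iff_getElem.1 h.2 b a hb ha hlt hib hia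

theorem block_eq {B C : ℕ × List ℕ} (hB : B ∈ L) (hC : C ∈ L)
    (hiB : i ∈ blockWord B) (hiC : i ∈ blockWord C) : B = C := by
  obtain ⟨a, ha, rfl⟩ := List.getElem_of_mem hB
  obtain ⟨b, hb, rfl⟩ := List.getElem_of_mem hC
  have := h.index_eq ha hb hiB hiC
  subst this; rfl

theorem notMem_take (hm : m < L.length) (hi : i ∈ blockWord L[m]) :
    i ∉ assemble (L.take m) := by
  intro hc
  obtain ⟨B, hB, hiB⟩ := mem_assemble.1 hc
  obtain ⟨a, ha, rfl⟩ := List.getElem_of_mem hB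
  rw [List.getElem_take] at hiB
  simp only [List.length_take] at ha
  have := h.index_eq (by omega) hm hiB hi
  omega

theorem notMem_drop (hm : m < L.length) (hi : i ∈ blockWord L[m]) :
    i ∉ assemble (L.drop (m + 1)) := by
  intro hc
  obtain ⟨B, hB, hiB⟩ := mem_assemble.1 hc
  obtain ⟨a, ha, rfl⟩ := List.getElem_of_mem hB
  rw [List.getElem_drop] at hiB
  simp only [List.length_drop] at ha
  have := h.index_eq (by omega) hm hiB hi
  omega

theorem firstPos_eq (hm : m < L.length) (hi : i ∈ blockWord L[m]) :
    firstPos (assemble L) i = startPos L m + firstPos (blockWord L[m]) i := by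
  rw [assemble_split L hm, firstPos_segment hi (h.notMem_take hm hi), startPos]

theorem lastPos_eq (hm : m < L.length) (hi : i ∈ blockWord L[m]) :
    lastPos (assemble L) i = startPos L m + lastPos (blockWord L[m]) i := by
  rw [assemble_split L hm, lastPos_segment hi (h.notMem_drop hm hi), startPos]

theorem firstPos_head (hm : m < L.length) : firstPos (assemble L) L[m].1 = startPos L m := by
  rw [h.firstPos_eq hm (mem_blockWord.2 (Or.inl rfl)), firstPos_blockWord, add_zero]

theorem lastPos_head (hm : m < L.length) :
    lastPos (assemble L) L[m].1 + 1 = startPos L (m + 1) := by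
  rw [h.lastPos_eq hm (mem_blockWord.2 (Or.inl rfl)), lastPos_blockWord, startPos_succ hm]
  ring

/-- The blocks of the list occupy disjoint intervals of positions, so containment can only happen
within one of them. -/
theorem index_eq_of_blockSub {a b : ℕ} (ha : a < L.length) (hb : b < L.length)
    (hi : i ∈ blockWord L[a]) (hj : j ∈ blockWord L[b]) (hs : BlockSub (assemble L) i j) :
    a = b := by
  obtain ⟨-, h1, h2⟩ := hs
  rw [h.firstPos_eq ha hi, h.firstPos_eq hb hj] at h1
  rw [h.lastPos_eq ha hi, h.lastPos_eq hb hj] at h2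
  have e1 := firstPos_lt hi
  have e2 := lastPos_lt hj
  rw [length_blockWord] at e1 e2
  have e3 := startPos_succ ha
  have e4 := startPos_succ hb
  by_contra hne
  rcases Nat.lt_or_gt_of_ne hne with hlt | hlt
  · have := startPos_mono L (show a + 1 ≤ b from hlt); omega
  · have := startPos_mono L (show b + 1 ≤ a from hlt); omega

theorem block_eq_of_blockSub {B C : ℕ × List ℕ} (hB : B ∈ L) (hC : C ∈ L)
    (hi : i ∈ blockWord B) (hj : j ∈ blockWord C) (hs : BlockSub (assemble L) i j) :
    B = C := by
  obtain ⟨a, ha, rfl⟩ := List.getElem_of_mem hB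
  obtain ⟨b, hb, rfl⟩ := List.getElem_of_mem hC
  have := h.index_eq_of_blockSub ha hb hi hj hs
  subst this; rfl

theorem exists_segment {B : ℕ × List ℕ} (hB : B ∈ L) : ∃ pre post : List ℕ,
    assemble L = pre ++ B.2 ++ post ∧ ∀ i ∈ B.2, i ∉ pre ∧ i ∉ post := by
  obtain ⟨m, hm, rfl⟩ := List.getElem_of_mem hB
  refine ⟨assemble (L.take m) ++ [L[m].1], [L[m].1] ++ assemble (L.drop (m + 1)), ?_, ?_⟩
  · rw [assemble_split L hm]; simp [blockWord]
  · intro i hi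
    have hi' := mem_blockWord.2 (Or.inr hi)
    have hne : i ≠ L[m].1 := fun e => h.1 _ hB (e ▸ hi)
    simp [hne, h.notMem_take hm hi', h.notMem_drop hm hi']

theorem blockSub_head {B : ℕ × List ℕ} (hB : B ∈ L) (hi : i ∈ B.2) :
    BlockSub (assemble L) i B.1 := by
  have hne : i ≠ B.1 := fun e => h.1 _ hB (e ▸ hi)
  have hi' := mem_blockWord.2 (Or.inr hi)
  obtain ⟨m, hm, rfl⟩ := List.getElem_of_mem hB
  refine ⟨hne, ?_, ?_⟩
  · rw [h.firstPos_head hm, h.firstPos_eq hm hi']; omega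
  · have := h.lastPos_head hm
    rw [startPos_succ hm] at this
    rw [h.lastPos_eq hm hi']
    have := lastPos_lt hi'
    rw [length_blockWord] at this
    omega

theorem mem_of_blockSub_head {B : ℕ × List ℕ} (hB : B ∈ L) (hi : i ∈ assemble L)
    (hs : BlockSub (assemble L) i B.1) : i ∈ B.2 := by
  obtain ⟨C, hC, hiC⟩ := mem_assemble.1 hi
  obtain rfl := h.block_eq_of_blockSub hC hB hiC (mem_blockWord.2 (Or.inl rfl)) hs
  exact (mem_blockWord.1 hiC).resolve_left hs.1

theorem not_blockSub_head {B : ℕ × List ℕ} (hB : B ∈ L) (hj : j ∈ assemble L) :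
    ¬ BlockSub (assemble L) B.1 j := by
  intro hs
  obtain ⟨C, hC, hjC⟩ := mem_assemble.1 hj
  obtain rfl := h.block_eq_of_blockSub hB hC (mem_blockWord.2 (Or.inl rfl)) hjC hs
  have hj2 := (mem_blockWord.1 hjC).resolve_left (Ne.symm hs.1)
  have h1 := (h.blockSub_head hB hj2).2.1
  have := firstPos_inj hj (le_antisymm hs.2.1 h1)
  exact hs.1 this.symm

theorem firstPos_inside {B : ℕ × List ℕ} (hB : B ∈ L) : ∃ c, ∀ i ∈ B.2,
    firstPos (assemble L) i = c + firstPos B.2 i ∧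
      lastPos (assemble L) i = c + lastPos B.2 i := by
  obtain ⟨pre, post, e, hn⟩ := h.exists_segment hB
  exact ⟨pre.length, fun i hi => by
    rw [e, firstPos_segment hi (hn i hi).1, lastPos_segment hi (hn i hi).2]; simp⟩

theorem blockSub_inside {B : ℕ × List ℕ} (hB : B ∈ L) (hi : i ∈ B.2) (hj : j ∈ B.2) :
    BlockSub (assemble L) i j ↔ BlockSub B.2 i j := by
  obtain ⟨c, hc⟩ := h.firstPos_inside hB
  simp [BlockSub, (hc i hi).1, (hc j hj).1, (hc i hi).2, (hc j hj).2]

theorem inner_inside {B : ℕ × List ℕ} (hB : B ∈ L) (hi : i ∈ B.2) :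
    inner (assemble L) i = inner B.2 i := by
  obtain ⟨pre, post, e, hn⟩ := h.exists_segment hB
  rw [e, inner_segment hi (hn i hi).1 (hn i hi).2]

theorem inner_head {B : ℕ × List ℕ} (hB : B ∈ L) : inner (assemble L) B.1 = B.2 := by
  obtain ⟨m, hm, rfl⟩ := List.getElem_of_mem hB
  have hi := mem_blockWord (B := L[m]) |>.2 (Or.inl rfl)
  rw [assemble_split L hm, inner_segment hi (h.notMem_take hm hi) (h.notMem_drop hm hi),
    inner_blockWord]

theorem isLevel_one : IsLevel (assemble L) 1 i ↔ ∃ B ∈ L, i = B.1 := by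
  constructor
  · rintro ⟨hi, hn⟩
    obtain ⟨B, hB, hiB⟩ := mem_assemble.1 hi
    refine ⟨B, hB, (mem_blockWord.1 hiB).resolve_right fun hi2 => ?_⟩
    exact hn _ (mem_assemble.2 ⟨B, hB, mem_blockWord.2 (Or.inl rfl)⟩) (h.blockSub_head hB hi2)
  · rintro ⟨B, hB, rfl⟩
    exact ⟨mem_assemble.2 ⟨B, hB, mem_blockWord.2 (Or.inl rfl)⟩,
      fun j hj => h.not_blockSub_head hB hj⟩

/-- The parent of a level 2 block is an outer letter, whose `inner` word is `B.2`. A deeper parent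
lies inside some `B.2`, where containment and `inner` are the same as in the whole word; this gives
the induction. -/
theorem isLevel_add_two {l : ℕ} :
    IsLevel (assemble L) (l + 2) i ↔ ∃ B ∈ L, IsLevel B.2 (l + 1) i := by
  induction l generalizing i with
  | zero =>
    constructor
    · rintro ⟨j, hj, hs, h1⟩
      obtain ⟨B, hB, rfl⟩ := h.isLevel_one.1 hj
      rw [h.inner_head hB] at h1
      exact ⟨B, hB, h1⟩
    · rintro ⟨B, hB, h1⟩
      exact ⟨B.1, h.isLevel_one.2 ⟨B, hB, rfl⟩, h.blockSub_head hB h1.1,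
        by rw [h.inner_head hB]; exact h1⟩
  | succ l ih =>
    constructor
    · rintro ⟨j, hj, hs, h1⟩
      obtain ⟨B, hB, hj'⟩ := ih.1 hj
      rw [h.inner_inside hB hj'.mem] at h1
      exact ⟨B, hB, j, hj', (h.blockSub_inside hB (inner_subset h1.1) hj'.mem).1 hs, h1⟩
    · rintro ⟨B, hB, j, hj, hs, h1⟩
      exact ⟨j, ih.2 ⟨B, hB, hj⟩, (h.blockSub_inside hB (inner_subset h1.1) hj.mem).2 hs,
        by rw [h.inner_inside hB hj.mem]; exact h1⟩

theorem isLevel_inside {l : ℕ} {B : ℕ × List ℕ} (hB : B ∈ L) (hi : i ∈ B.2) :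
    IsLevel (assemble L) (l + 2) i ↔ IsLevel B.2 (l + 1) i := by
  rw [h.isLevel_add_two]
  refine ⟨?_, fun hl => ⟨B, hB, hl⟩⟩
  rintro ⟨C, hC, hl⟩
  obtain rfl := h.block_eq hB hC (mem_blockWord.2 (Or.inr hi)) (mem_blockWord.2 (Or.inr hl.mem))
  exact hl

theorem not_isLevel_one {B : ℕ × List ℕ} (hB : B ∈ L) (hi : i ∈ B.2) :
    ¬ IsLevel (assemble L) 1 i :=
  fun hl => hl.2 _ (mem_assemble.2 ⟨B, hB, mem_blockWord.2 (Or.inl rfl)⟩) (h.blockSub_head hB hi)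

theorem isParent_inside {B : ℕ × List ℕ} (hB : B ∈ L) (hi : i ∈ B.2) (hj : j ∈ B.2) :
    IsParent (assemble L) j i ↔ IsParent B.2 j i := by
  unfold IsParent
  rw [h.blockSub_inside hB hi hj]
  refine and_congr_right fun _ => ⟨?_, ?_⟩
  · rintro ⟨l, h1, h2⟩
    match l with
    | 0 => exact h2.elim
    | 1 => exact (h.not_isLevel_one hB hj h2).elim
    | l + 2 => exact ⟨l + 1, (h.isLevel_inside hB hi).1 h1, (h.isLevel_inside hB hj).1 h2⟩
  · rintro ⟨l, h1, h2⟩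
    match l with
    | 0 => exact h2.elim
    | l + 1 => exact ⟨l + 2, (h.isLevel_inside hB hi).2 h1, (h.isLevel_inside hB hj).2 h2⟩

theorem isParent_head {B : ℕ × List ℕ} (hB : B ∈ L) :
    IsParent (assemble L) B.1 i ↔ IsLevel B.2 1 i := by
  constructor
  · rintro ⟨hs, l, h1, h2⟩
    have hi := h.mem_of_blockSub_head hB h1.mem hs
    match l with
    | 0 => exact h2.elim
    | 1 => exact (h.isLevel_inside hB hi).1 h1
    -- At level 2 or deeper, `B.1` would lie in the interior of a block, which by disjointness is
    -- `B` itself; but `B.1 ∉ B.2`.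
    | l + 2 =>
      obtain ⟨C, hC, hl⟩ := h.isLevel_add_two.1 h2
      have := h.block_eq hB hC (mem_blockWord.2 (Or.inl rfl)) (mem_blockWord.2 (Or.inr hl.mem))
      subst this
      exact (h.1 _ hB hl.mem).elim
  · intro hl
    exact ⟨h.blockSub_head hB hl.mem, 1, (h.isLevel_inside hB hl.mem).2 hl,
      h.isLevel_one.2 ⟨B, hB, rfl⟩⟩

/-- A common parent of letters below the outer level is either `B.1`, which makes both of level 1 in
`B.2`, or a letter of `B.2`. Siblings therefore never straddle two interiors. -/
theorem areSiblings_inside {B : ℕ × List ℕ} (hB : B ∈ L) (hi : i ∈ B.2) :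
    AreSiblings (assemble L) i j ↔ j ∈ B.2 ∧ AreSiblings B.2 i j := by
  constructor
  · rintro (⟨h1, -⟩ | ⟨k, hk, hk'⟩)
    · exact (h.not_isLevel_one hB hi h1).elim
    · have hj : j ∈ assemble L := by obtain ⟨-, l, hl, -⟩ := hk'; exact hl.mem
      have hmem : k ∈ assemble L := by obtain ⟨-, l, -, hl⟩ := hk; exact hl.mem
      obtain ⟨C, hC, hkC⟩ := mem_assemble.1 hmem
      obtain rfl := h.block_eq_of_blockSub hB hC (mem_blockWord.2 (Or.inr hi)) hkC hk.1
      rcases mem_blockWord.1 hkC with rfl | hkB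
      · rw [h.isParent_head hB] at hk hk'
        exact ⟨hk'.mem, Or.inl ⟨hk, hk'⟩⟩
      · have hjB : j ∈ B.2 := by
          obtain ⟨D, hD, hjD⟩ := mem_assemble.1 hj
          obtain rfl := h.block_eq_of_blockSub hD hB hjD hkC hk'.1
          refine (mem_blockWord.1 hjD).resolve_left ?_
          rintro rfl
          exact h.not_blockSub_head hB hmem hk'.1
        exact ⟨hjB, Or.inr ⟨k, (h.isParent_inside hB hi hkB).1 hk,
          (h.isParent_inside hB hjB hkB).1 hk'⟩⟩
  · rintro ⟨hj, ⟨h1, h2⟩ | ⟨k, hk, hk'⟩⟩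
    · exact Or.inr ⟨B.1, (h.isParent_head hB).2 h1, (h.isParent_head hB).2 h2⟩
    · have hkB : k ∈ B.2 := by obtain ⟨-, l, -, hl⟩ := hk; exact hl.mem
      exact Or.inr ⟨k, (h.isParent_inside hB hi hkB).2 hk, (h.isParent_inside hB hj hkB).2 hk'⟩

theorem nodup : L.Nodup := by
  refine h.2.imp fun {B C} hd e => ?_
  subst e
  exact hd (a := B.1) (mem_blockWord.2 (Or.inl rfl)) (mem_blockWord.2 (Or.inl rfl))

end Separated

/-! ### Counting blocks and block patterns -/

theorem finite_isLevel (w : List ℕ) (l : ℕ) : {i | IsLevel w l i}.Finite :=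
  (w.toFinset.finite_toSet).subset fun i hi => by simpa using IsLevel.mem hi

theorem PermPattern.finite_blockOccurrences (p : PermPattern) (w : List ℕ) (l : ℕ) :
    (p.blockOccurrences w l).Finite :=
  (Set.Finite.pi' fun _ : Fin p.len => finite_isLevel w l).subset fun _ hb => hb.2.1

theorem ncard_biUnion_list {α β : Type*} (L : List α) (f : α → Set β)
    (hfin : ∀ a ∈ L, (f a).Finite) (hd : L.Pairwise fun a b => Disjoint (f a) (f b)) :
    (⋃ a ∈ L, f a).ncard = (L.map fun a => (f a).ncard).sum := by
  induction L with
  | nil => simp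
  | cons a L ih =>
    rw [List.pairwise_cons] at hd
    have hfin' : (⋃ b ∈ L, f b).Finite := by
      have := Set.Finite.biUnion (s := {b | b ∈ L}) (List.finite_toSet L)
        (t := f) fun b hb => hfin b (by simp [show b ∈ L from hb])
      simpa using this
    have e : (⋃ b ∈ a :: L, f b) = f a ∪ ⋃ b ∈ L, f b := by
      ext; simp
    rw [e, Set.ncard_union_eq _ (hfin a (by simp)) hfin', List.map_cons, List.sum_cons,
      ih (fun b hb => hfin b (by simp [hb])) hd.2]
    simp only [Set.disjoint_iUnion_right]
    exact fun b hb => hd.1 b hb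

theorem startPos_lt {L : List (ℕ × List ℕ)} {a b : ℕ} (hb : b < L.length) : startPos L a < startPos L b ↔ a < b := by
  constructor
  · intro hlt
    by_contra hn
    have := startPos_mono L (not_lt.1 hn)
    omega
  · intro hlt
    have := startPos_succ (L := L) (m := a) (by omega)
    have := startPos_mono L (show a + 1 ≤ b from hlt)
    omega

/-- Blocks are nonempty, so different indices start at different positions. With `lastPos_head`,
this turns an underline between blocks into consecutiveness of their indices. -/
theorem startPos_eq {L : List (ℕ × List ℕ)} {a b : ℕ} (ha : a < L.length) (hb : b < L.length) :
    startPos L b = startPos L (a + 1) ↔ b = a + 1 := by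
  refine ⟨fun e => ?_, fun e => by rw [e]⟩
  have h1 := startPos_succ ha
  have h2 := startPos_succ hb
  rcases Nat.lt_trichotomy b (a + 1) with hlt | he | hlt
  · have := startPos_mono L (show b ≤ a by omega); omega
  · exact he
  · have := (startPos_lt hb).2 hlt; omega

namespace Separated
variable {L : List (ℕ × List ℕ)} (h : Separated L)
include h

theorem blockCount_one : blockCount (assemble L) 1 = L.length := by
  have e : {i | IsLevel (assemble L) 1 i} = ((L.map Prod.fst).toFinset : Set ℕ) := by
    ext i
    simp only [Set.mem_ofPred_eq, h.isLevel_one, List.coe_toFinset, List.mem_map]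
    exact ⟨fun ⟨B, hB, e⟩ => ⟨B, hB, e.symm⟩, fun ⟨B, hB, e⟩ => ⟨B, hB, e.symm⟩⟩
  rw [blockCount, e, Set.ncard_coe_finset, List.toFinset_card_of_nodup, List.length_map]
  refine List.Nodup.map_on (fun B hB C hC e => ?_) h.nodup
  exact h.block_eq hB hC (mem_blockWord.2 (Or.inl rfl)) (mem_blockWord.2 (Or.inl e))

theorem blockCount_add_two (l : ℕ) :
    blockCount (assemble L) (l + 2) = (L.map fun B => blockCount B.2 (l + 1)).sum := by
  have e : {i | IsLevel (assemble L) (l + 2) i} = ⋃ B ∈ L, {i | IsLevel B.2 (l + 1) i} := by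
    ext i
    simp [h.isLevel_add_two]
  rw [blockCount, e, ncard_biUnion_list _ _ fun B _ => finite_isLevel _ _]
  · rfl
  · refine h.2.imp fun {B C} hd => Set.disjoint_left.2 fun i hi hj => ?_
    exact hd (mem_blockWord.2 (Or.inr (IsLevel.mem hi))) (mem_blockWord.2 (Or.inr (IsLevel.mem hj)))

/-- The sibling condition confines an occurrence to one interior, and passing to the interior
translates all positions by a constant. The convention that `∅` never occurs is essential: the first
entry selects the interior. -/
theorem blockOccurrences_add_two (p : PermPattern) (l : ℕ) :
    p.blockOccurrences (assemble L) (l + 2) = ⋃ B ∈ L, p.blockOccurrences B.2 (l + 1) := by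
  have key : ∀ B ∈ L, ∀ b : Fin p.len → ℕ, (∀ s, b s ∈ B.2) →
      (b ∈ p.blockOccurrences (assemble L) (l + 2) ↔ b ∈ p.blockOccurrences B.2 (l + 1)) := by
    intro B hB b hb
    obtain ⟨c, hc⟩ := h.firstPos_inside hB
    have e1 : ∀ s t, AreSiblings (assemble L) (b s) (b t) ↔ AreSiblings B.2 (b s) (b t) :=
      fun s t => by rw [h.areSiblings_inside hB (hb s)]; simp [hb t]
    have e2 : StrictMono (fun s => firstPos (assemble L) (b s)) ↔
        StrictMono (fun s => firstPos B.2 (b s)) := by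
      simp only [StrictMono, (hc _ (hb _)).1, Nat.add_lt_add_iff_left]
    have e3 : ∀ s t, firstPos (assemble L) (b t) = lastPos (assemble L) (b s) + 1 ↔
        firstPos B.2 (b t) = lastPos B.2 (b s) + 1 := by
      intro s t
      rw [(hc _ (hb t)).1, (hc _ (hb s)).2]
      omega
    simp only [PermPattern.blockOccurrences, Set.mem_ofPred_eq, e1, e2, e3,
      h.isLevel_inside hB (hb _)]
  ext b
  simp only [Set.mem_iUnion]
  constructor
  · intro hb
    have hpos := hb.1
    obtain ⟨B, hB, hl⟩ := h.isLevel_add_two.1 (hb.2.1 ⟨0, hpos⟩)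
    refine ⟨B, hB, (key B hB b fun s => ?_).1 hb⟩
    exact ((h.areSiblings_inside hB hl.mem).1 (hb.2.2.1 ⟨0, hpos⟩ s)).1
  · rintro ⟨B, hB, hb⟩
    exact (key B hB b fun s => (hb.2.1 s).mem).2 hb

theorem levelCount_add_two (p : PermPattern) (l : ℕ) :
    p.levelCount (assemble L) (l + 2) = (L.map fun B => p.levelCount B.2 (l + 1)).sum := by
  rw [PermPattern.levelCount, h.blockOccurrences_add_two, ncard_biUnion_list _ _
    fun B _ => p.finite_blockOccurrences _ _]
  · rfl
  · refine h.2.imp fun {B C} hd => Set.disjoint_left.2 fun b hi hj => ?_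
    exact hd (mem_blockWord.2 (Or.inr (hi.2.1 ⟨0, hi.1⟩).mem))
      (mem_blockWord.2 (Or.inr (hj.2.1 ⟨0, hi.1⟩).mem))

/-- All outer letters are siblings, and position order and adjacency of their blocks are those of
the indices; so only the word of outer letters matters. -/
theorem levelCount_one (p : PermPattern) :
    p.levelCount (assemble L) 1 = (p.occurrences fun m : Fin L.length => (L[m]).1).ncard := by
  have e : p.blockOccurrences (assemble L) 1 =
      (fun i s => (L[i s]).1) '' (p.occurrences fun m : Fin L.length => (L[m]).1) := by
    have key : ∀ i : Fin p.len → Fin L.length,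
        (fun s => (L[i s]).1) ∈ p.blockOccurrences (assemble L) 1 ↔
          i ∈ p.occurrences fun m : Fin L.length => (L[m]).1 := by
      intro i
      have e1 : ∀ m : Fin L.length, IsLevel (assemble L) 1 (L[m]).1 := fun m =>
        h.isLevel_one.2 ⟨_, List.getElem_mem m.2, rfl⟩
      have e2 : ∀ s t, AreSiblings (assemble L) (L[i s]).1 (L[i t]).1 := fun s t =>
        Or.inl ⟨e1 _, e1 _⟩
      have e3 : StrictMono (fun s => firstPos (assemble L) (L[i s]).1) ↔ StrictMono i := by
        simp only [StrictMono, Fin.getElem_fin, h.firstPos_head (Fin.is_lt _),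
          startPos_lt (Fin.is_lt _), Fin.lt_def]
      have e4 : ∀ s t, firstPos (assemble L) (L[i t]).1 = lastPos (assemble L) (L[i s]).1 + 1 ↔
          (i t : ℕ) = i s + 1 := by
        intro s t
        simp only [Fin.getElem_fin]
        rw [h.firstPos_head (i t).2, h.lastPos_head (i s).2, startPos_eq (i s).2 (i t).2]
      simp only [PermPattern.blockOccurrences, PermPattern.occurrences, Set.mem_ofPred_eq, e1, e2,
        e3, e4, implies_true, true_and]
    ext b
    constructor
    · intro hb
      have : ∀ s, ∃ m : Fin L.length, b s = (L[m]).1 := fun s => by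
        obtain ⟨B, hB, e⟩ := h.isLevel_one.1 (hb.2.1 s)
        obtain ⟨m, hm, rfl⟩ := List.getElem_of_mem hB
        exact ⟨⟨m, hm⟩, e⟩
      choose i hi using this
      obtain rfl : b = fun s => (L[i s]).1 := funext hi
      exact ⟨i, (key i).1 hb, rfl⟩
    · rintro ⟨i, hi, rfl⟩
      exact (key i).2 hi
  rw [PermPattern.levelCount, e, Set.ncard_image_of_injective]
  intro i i' he
  funext s
  have := congrFun he s
  exact Fin.ext (h.index_eq (i s).2 (i' s).2 (mem_blockWord.2 (Or.inl rfl))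
    (mem_blockWord.2 (Or.inl this)))

end Separated

/-! ### Invariance under increasing relabelling -/

section Relabel
variable {φ : ℕ → ℕ} (hφ : StrictMono φ) (w : List ℕ) (i j : ℕ)
include hφ

/-- Levels, parents and pattern occurrences are built from first and last positions and comparisons
of letters, so this is the root of their invariance. -/
theorem idxOf_map_strictMono : (w.map φ).idxOf (φ i) = w.idxOf i := by
  induction w with
  | nil => simp
  | cons a w ih =>
    by_cases e : a = i
    · simp [e]
    · have e' : φ a ≠ φ i := hφ.injective.ne e
      simp [List.idxOf_cons_ne _ e, List.idxOf_cons_ne _ e', ih]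

theorem firstPos_map : firstPos (w.map φ) (φ i) = firstPos w i := idxOf_map_strictMono hφ w i

theorem lastPos_map : lastPos (w.map φ) (φ i) = lastPos w i := by
  rw [lastPos, ← List.map_reverse, idxOf_map_strictMono hφ, List.length_map, lastPos]

theorem inner_map : inner (w.map φ) (φ i) = (inner w i).map φ := by
  rw [inner, firstPos_map hφ, lastPos_map hφ, inner, List.map_drop, List.map_take]

theorem blockSub_map : BlockSub (w.map φ) (φ i) (φ j) ↔ BlockSub w i j := by
  simp only [BlockSub, firstPos_map hφ, lastPos_map hφ, hφ.injective.ne_iff]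

theorem isLevelOne_map : IsLevelOne (w.map φ) (φ i) ↔ IsLevelOne w i := by
  simp [IsLevelOne, hφ.injective.eq_iff, blockSub_map hφ]

theorem isLevel_map (l : ℕ) : IsLevel (w.map φ) l (φ i) ↔ IsLevel w l i := by
  induction l using Nat.strong_induction_on generalizing i with
  | _ l ih =>
  match l with
  | 0 => rfl
  | 1 => exact isLevelOne_map hφ w i
  | l + 2 =>
    constructor
    · rintro ⟨j, hj, hs, h1⟩
      obtain ⟨j, -, rfl⟩ := List.mem_map.1 hj.mem
      rw [inner_map hφ, isLevelOne_map hφ] at h1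
      exact ⟨j, (ih _ (by omega) _).1 hj, (blockSub_map hφ _ _ _).1 hs, h1⟩
    · rintro ⟨j, hj, hs, h1⟩
      exact ⟨φ j, (ih _ (by omega) _).2 hj, (blockSub_map hφ _ _ _).2 hs,
        by rwa [inner_map hφ, isLevelOne_map hφ]⟩

theorem isParent_map : IsParent (w.map φ) (φ j) (φ i) ↔ IsParent w j i := by
  simp only [IsParent, blockSub_map hφ, isLevel_map hφ]

theorem areSiblings_map : AreSiblings (w.map φ) (φ i) (φ j) ↔ AreSiblings w i j := by
  simp only [AreSiblings, isLevel_map hφ]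
  refine or_congr_right ⟨?_, ?_⟩
  · rintro ⟨k, hk, hk'⟩
    have hm : k ∈ w.map φ := by obtain ⟨-, l, -, hl⟩ := hk; exact hl.mem
    obtain ⟨k, -, rfl⟩ := List.mem_map.1 hm
    exact ⟨k, (isParent_map hφ _ _ _).1 hk, (isParent_map hφ _ _ _).1 hk'⟩
  · rintro ⟨k, hk, hk'⟩
    exact ⟨φ k, (isParent_map hφ _ _ _).2 hk, (isParent_map hφ _ _ _).2 hk'⟩

theorem blockCount_map (l : ℕ) : blockCount (w.map φ) l = blockCount w l := by
  have : {i | IsLevel (w.map φ) l i} = φ '' {i | IsLevel w l i} := by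
    ext j
    constructor
    · intro hj
      obtain ⟨i, -, rfl⟩ := List.mem_map.1 (IsLevel.mem hj)
      exact ⟨i, (isLevel_map hφ _ _ _).1 hj, rfl⟩
    · rintro ⟨i, hi, rfl⟩
      exact (isLevel_map hφ _ _ _).2 hi
  rw [blockCount, this, Set.ncard_image_of_injective _ hφ.injective, blockCount]

theorem levelCount_map (p : PermPattern) (l : ℕ) :
    p.levelCount (w.map φ) l = p.levelCount w l := by
  have key : ∀ b : Fin p.len → ℕ, φ ∘ b ∈ p.blockOccurrences (w.map φ) l ↔
      b ∈ p.blockOccurrences w l := by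
    intro b
    simp only [PermPattern.blockOccurrences, Set.mem_ofPred_eq, Function.comp_apply,
      isLevel_map hφ, areSiblings_map hφ, firstPos_map hφ, lastPos_map hφ, PermPattern.Matches,
      hφ.lt_iff_lt]
  have : p.blockOccurrences (w.map φ) l = (φ ∘ ·) '' p.blockOccurrences w l := by
    ext b
    constructor
    · intro hb
      have : ∀ s, ∃ i, φ i = b s := fun s => by
        obtain ⟨i, -, e⟩ := List.mem_map.1 (hb.2.1 s).mem
        exact ⟨i, e⟩
      choose c hc using this
      obtain rfl : φ ∘ c = b := funext hc
      exact ⟨c, (key c).1 hb, rfl⟩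
    · rintro ⟨c, hc, rfl⟩
      exact (key c).2 hc
  rw [PermPattern.levelCount, this,
    Set.ncard_image_of_injective _ hφ.injective.comp_left, PermPattern.levelCount]

end Relabel

/-! ### Stirling permutations of a finite set of letters -/

/-- Every letter of `σ` occurs twice, and the letters in between are larger. -/
def IsStirlingPerm (σ : List ℕ) : Prop :=
  (∀ i ∈ σ, σ.count i = 2) ∧ ∀ i j, [i, j, i].Sublist σ → i < j

/-- The form with subwords `i j i` passes easily to subwords, concatenations and relabellings. -/
theorem isStirlingWord_iff {w : List ℕ} :
    IsStirlingWord w ↔ ∀ i j, [i, j, i].Sublist w → i < j := by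
  constructor
  · intro h i j hs
    obtain ⟨f, hf⟩ := List.sublist_iff_exists_fin_orderEmbedding_get_eq.1 hs
    have e0 := hf ⟨0, by simp⟩
    have e1 := hf ⟨1, by simp⟩
    have e2 := hf ⟨2, by simp⟩
    refine h (f ⟨0, by simp⟩) (f ⟨1, by simp⟩) (f ⟨2, by simp⟩) i j ?_ ?_ ?_ ?_ ?_
    · exact f.strictMono (by simp)
    · exact f.strictMono (by simp)
    · rw [List.getElem?_eq_getElem (Fin.is_lt _)]; exact congrArg some e0.symm
    · rw [List.getElem?_eq_getElem (Fin.is_lt _)]; exact congrArg some e2.symm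
    · rw [List.getElem?_eq_getElem (Fin.is_lt _)]; exact congrArg some e1.symm
  · intro h a b c i j hab hbc ha hc hb
    apply h
    obtain ⟨ha', rfl⟩ := List.getElem?_eq_some_iff.1 ha
    obtain ⟨hb', rfl⟩ := List.getElem?_eq_some_iff.1 hb
    obtain ⟨hc', e⟩ := List.getElem?_eq_some_iff.1 hc
    have h1 : [w[b]].Sublist (w.take c |>.drop (a + 1)) := by
      rw [List.singleton_sublist, List.mem_iff_getElem]
      refine ⟨b - (a + 1), by simp; omega, ?_⟩
      simp only [List.getElem_drop, List.getElem_take]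
      congr 1; omega
    have h2 : w = w.take a ++ (w[a] :: ((w.take c).drop (a + 1) ++ w[a] :: w.drop (c + 1))) := by
      conv_lhs => rw [← List.take_append_drop c w, List.drop_eq_getElem_cons hc', e,
        ← List.take_append_drop a (w.take c),
        List.drop_eq_getElem_cons (l := w.take c) (i := a) (by simp; omega)]
      simp [List.take_take, Nat.min_eq_left (hab.trans hbc).le]
    have h3 : [w[a], w[b], w[a]].Sublist
        (w.take a ++ (w[a] :: ((w.take c).drop (a + 1) ++ w[a] :: w.drop (c + 1)))) :=
      List.Sublist.trans (List.Sublist.cons_cons _ <|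
        h1.append (l₁ := [w[b]]) (r₁ := [w[a]]) (by simp)) (List.sublist_append_right _ _)
    rwa [← h2] at h3

/-- The Stirling permutations with set of letters `S`. -/
noncomputable def stirlingOn (S : Finset ℕ) : Finset (List ℕ) :=
  open Classical in (2 • S.val).lists.toFinset.filter IsStirlingWord

theorem stirlingPerms_eq (n : ℕ) : stirlingPerms n = stirlingOn (Finset.Icc 1 n) := rfl

theorem mem_stirlingOn {S : Finset ℕ} {σ : List ℕ} :
    σ ∈ stirlingOn S ↔ σ.toFinset = S ∧ IsStirlingPerm σ := by
  simp only [stirlingOn, Finset.mem_filter, Multiset.mem_toFinset, Multiset.mem_lists_iff,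
    isStirlingWord_iff, IsStirlingPerm, ← and_assoc]
  refine and_congr_left fun _ => ?_
  simp only [Multiset.quot_mk_to_coe, Multiset.ext, Multiset.count_nsmul, Multiset.coe_count]
  constructor
  · intro h
    have e : σ.toFinset = S := by
      ext i
      rw [List.mem_toFinset, ← List.count_pos_iff, ← Finset.mem_val, ← Multiset.count_pos]
      have := h i
      omega
    refine ⟨e, fun i hi => ?_⟩
    rw [← h, Multiset.count_eq_one_of_mem S.nodup (by simpa [← e] using hi)]
  · rintro ⟨rfl, h⟩ i
    by_cases hi : i ∈ σ
    · rw [h i hi, Multiset.count_eq_one_of_mem (Finset.nodup _) (by simpa using hi)]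
    · rw [List.count_eq_zero.2 hi, Multiset.count_eq_zero.2 (by simpa using hi)]

theorem IsStirlingPerm.nil : IsStirlingPerm [] := by simp [IsStirlingPerm]

/-- A subword `i j i` meeting both factors would put its first `i` in `u` and its last `i` in `v`,
against disjointness. -/
theorem IsStirlingPerm.append {u v : List ℕ} (hu : IsStirlingPerm u) (hv : IsStirlingPerm v)
    (hd : u.Disjoint v) : IsStirlingPerm (u ++ v) := by
  constructor
  · intro i hi
    rw [List.count_append]
    rcases List.mem_append.1 hi with h | h
    · rw [hu.1 i h, List.count_eq_zero.2 fun h' => hd h h']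
    · rw [hv.1 i h, List.count_eq_zero.2 fun h' => hd h' h]
  · intro i j hs
    obtain ⟨l₁, l₂, e, h1, h2⟩ := List.sublist_append_iff.1 hs
    match l₁ with
    | [] => exact hv.2 i j (by simpa [e] using h2)
    | a :: l =>
      rcases List.eq_nil_or_concat l₂ with rfl | ⟨l₂, c, rfl⟩
      · exact hu.2 i j (by simpa [e] using h1)
      · exfalso
        have e1 : i = a := by simpa using congrArg List.head? e
        have e2 : i = c := by simpa using congrArg (fun l => l.reverse.head?) e
        exact hd (a := i) (h1.subset (by simp [e1])) (h2.subset (by simp [e2]))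

theorem IsStirlingPerm.blockWord {b : ℕ} {w : List ℕ} (hw : IsStirlingPerm w)
    (hb : ∀ j ∈ w, b < j) : IsStirlingPerm (blockWord (b, w)) := by
  have hbw : b ∉ w := fun h => (hb b h).false
  have hc : (BlockPattern.blockWord (b, w)).count b = 2 := by
    simp [BlockPattern.blockWord, List.count_eq_zero.2 hbw]
  have hc' : ∀ i, i ≠ b → (BlockPattern.blockWord (b, w)).count i = w.count i := by
    intro i hi
    simp [BlockPattern.blockWord, List.count_append, Ne.symm hi]
  constructor
  · intro i hi
    by_cases h : i = b
    · rw [h, hc]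
    · rw [hc' i h, hw.1 i ((mem_blockWord.1 hi).resolve_left h)]
  · intro i j hs
    by_cases h : i = b
    · subst h
      rcases mem_blockWord.1 (hs.subset (show j ∈ [i, j, i] by simp)) with e | hj
      · have e' : j = i := e
        -- Here the subword is `j j j`, but `j` occurs only twice.
        subst e'
        have := hs.count_le j
        rw [hc] at this
        simp at this
      · exact hb j hj
    · refine hw.2 i j ?_
      have h1 : [i, j, i].Sublist (w ++ [b]) := by
        rcases List.sublist_cons_iff.1 hs with h' | ⟨r, e, -⟩
        · exact h'
        · exact absurd (by simpa using congrArg List.head? e) h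
      obtain ⟨l₁, l₂, e, h1, h2⟩ := List.sublist_append_iff.1 h1
      rcases List.eq_nil_or_concat l₂ with rfl | ⟨l₂, c, rfl⟩
      · simpa [e] using h1
      · have e2 : i = c := by simpa using congrArg (fun l => l.reverse.head?) e
        exact absurd (by simpa using h2.subset (show c ∈ l₂.concat c by simp)) (e2 ▸ h)

/-- Cut at the second `b`. A letter `j` on both sides of the cut would give subwords `b j b` and `j
b j`, hence `b < j < b`; so the pieces share no letter and each keeps both copies of its letters. -/
theorem IsStirlingPerm.exists_block {b : ℕ} {rest : List ℕ} (h : IsStirlingPerm (b :: rest)) :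
    ∃ w σ, b :: rest = BlockPattern.blockWord (b, w) ++ σ ∧ (∀ j ∈ w, b < j) ∧
      IsStirlingPerm w ∧ IsStirlingPerm σ ∧ (BlockPattern.blockWord (b, w)).Disjoint σ := by
  have hb := h.1 b (by simp)
  have hmem : b ∈ rest := by
    rw [← List.count_pos_iff]
    rw [List.count_cons_self] at hb; omega
  obtain ⟨w, σ, rfl, hbw⟩ := List.eq_append_cons_of_mem hmem
  have hbσ : b ∉ σ := by
    simp [List.count_append, List.count_eq_zero.2 hbw] at hb
    exact List.count_eq_zero.1 hb
  have hlt : ∀ j ∈ w, b < j := fun j hj => h.2 b j <| List.Sublist.cons_cons _ <|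
    (List.singleton_sublist.2 hj).append (l₁ := [j]) (r₁ := [b]) (by simp)
  have hdis : ∀ j ∈ w, j ∉ σ := fun j hj hj' => by
    have : j < b := h.2 j b <| List.Sublist.cons _ <|
      (List.singleton_sublist.2 hj).append (l₁ := [j]) (r₁ := [b, j]) (by simpa using hj')
    exact absurd (hlt j hj) this.not_gt
  have hcount : ∀ i, i ≠ b → (b :: (w ++ b :: σ)).count i = w.count i + σ.count i := by
    intro i hi
    simp [List.count_append, Ne.symm hi]
  refine ⟨w, σ, by simp [BlockPattern.blockWord], hlt, ⟨fun i hi => ?_, fun i j hs => ?_⟩,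
    ⟨fun i hi => ?_, fun i j hs => ?_⟩, fun i hi hi' => ?_⟩
  · have := h.1 i (by simp [hi])
    rw [hcount i (fun e => hbw (e ▸ hi)), List.count_eq_zero.2 (hdis i hi)] at this
    exact this
  · exact h.2 i j ((hs.trans (List.sublist_append_left _ _)).cons _)
  · have := h.1 i (by simp [hi])
    rw [hcount i (fun e => hbσ (e ▸ hi)), List.count_eq_zero.2 (fun h' => hdis i h' hi)] at this
    simpa using this
  · exact h.2 i j (((hs.cons _).trans (List.sublist_append_right _ _)).cons _)
  · rcases mem_blockWord.1 hi with e | h'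
    · exact hbσ (by rwa [show i = b from e] at hi')
    · exact hdis i h' hi'

/-- A list of blocks whose interiors are Stirling permutations of larger letters. -/
def IsBlockList (L : List (ℕ × List ℕ)) : Prop :=
  (∀ B ∈ L, IsStirlingPerm B.2 ∧ ∀ j ∈ B.2, B.1 < j) ∧
    L.Pairwise fun B C => (blockWord B).Disjoint (blockWord C)

theorem IsBlockList.separated {L : List (ℕ × List ℕ)} (h : IsBlockList L) : Separated L :=
  ⟨fun B hB hm => ((h.1 B hB).2 _ hm).false, h.2⟩

theorem isBlockList_cons {B : ℕ × List ℕ} {L : List (ℕ × List ℕ)} :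
    IsBlockList (B :: L) ↔ (IsStirlingPerm B.2 ∧ ∀ j ∈ B.2, B.1 < j) ∧
      (blockWord B).Disjoint (assemble L) ∧ IsBlockList L := by
  have : (blockWord B).Disjoint (assemble L) ↔ ∀ C ∈ L, (blockWord B).Disjoint (blockWord C) :=
    ⟨fun h C hC i hi hi' => h hi (mem_assemble.2 ⟨C, hC, hi'⟩), fun h i hi hi' => by
      obtain ⟨C, hC, hiC⟩ := mem_assemble.1 hi'
      exact h C hC hi hiC⟩
  rw [this, IsBlockList, IsBlockList, List.forall_mem_cons, List.pairwise_cons]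
  tauto

theorem IsBlockList.isStirlingPerm {L : List (ℕ × List ℕ)} (h : IsBlockList L) :
    IsStirlingPerm (assemble L) := by
  induction L with
  | nil => exact IsStirlingPerm.nil
  | cons B L ih =>
    rw [isBlockList_cons] at h
    exact (h.1.1.blockWord h.1.2).append (ih h.2.2) h.2.1

theorem IsStirlingPerm.exists_isBlockList {σ : List ℕ} (h : IsStirlingPerm σ) :
    ∃ L, IsBlockList L ∧ assemble L = σ := by
  induction hn : σ.length using Nat.strong_induction_on generalizing σ with
  | _ n ih =>
  match σ with
  | [] => exact ⟨[], by simp [IsBlockList], rfl⟩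
  | b :: rest =>
    obtain ⟨w, τ, e, hlt, hw, hτ, hd⟩ := h.exists_block
    obtain ⟨L, hL, rfl⟩ := ih τ.length (by
      have := congrArg List.length e
      rw [List.length_append, length_blockWord] at this; omega) hτ rfl
    exact ⟨(b, w) :: L, isBlockList_cons.2 ⟨⟨hw, hlt⟩, hd, hL⟩, by rw [e]; rfl⟩

theorem assemble_injective {L M : List (ℕ × List ℕ)} (hL : Separated L) (hM : Separated M)
    (e : assemble L = assemble M) : L = M := by
  induction L generalizing M with
  | nil =>
    cases M with
    | nil => rfl
    | cons C M => simp [assemble, blockWord] at e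
  | cons B L ih =>
    cases M with
    | nil => simp [assemble, blockWord] at e
    | cons C M =>
      obtain ⟨b, w⟩ := B
      obtain ⟨c, v⟩ := C
      simp only [assemble, blockWord, List.flatMap_cons, List.cons_append, List.append_assoc,
        List.cons.injEq, List.nil_append] at e
      obtain ⟨rfl, e⟩ := e
      have hb : b ∉ w := hL.1 (b, w) (by simp)
      have hc : b ∉ v := hM.1 (b, v) (by simp)
      -- After the opening `b` is removed, the next `b` is the closing one, so its position is the
      -- length of the interior.
      have hlen : w.length = v.length := by
        have := congrArg (List.idxOf b) e
        simpa [List.idxOf_append_of_notMem hb, List.idxOf_append_of_notMem hc] using this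
      obtain ⟨rfl, e'⟩ := List.append_inj e hlen
      rw [List.cons.injEq] at e'
      rw [ih ⟨fun B hB => hL.1 B (by simp [hB]), (List.pairwise_cons.1 hL.2).2⟩
        ⟨fun B hB => hM.1 B (by simp [hB]), (List.pairwise_cons.1 hM.2).2⟩ e'.2]

/-! ### Relabelling Stirling permutations -/

theorem isStirlingPerm_map {φ : ℕ → ℕ} (hφ : StrictMono φ) {w : List ℕ} :
    IsStirlingPerm (w.map φ) ↔ IsStirlingPerm w := by
  refine and_congr ?_ ⟨fun h i j hs => hφ.lt_iff_lt.1 (h _ _ (by simpa using hs.map φ)),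
    fun h i j hs => ?_⟩
  · simp [List.count_map_of_injective _ _ hφ.injective]
  · obtain ⟨l, hl, e⟩ := List.sublist_map_iff.1 hs
    match l with
    | [a, b, c] =>
      simp only [List.map_cons, List.map_nil, List.cons.injEq, and_true] at e
      obtain ⟨rfl, rfl, e⟩ := e
      rw [← hφ.injective e] at hl
      exact hφ (h _ _ hl)
    | [] => simp at e
    | [a] => simp at e
    | [a, b] => simp at e
    | a :: b :: c :: d :: l => simp at e

theorem stirlingOn_image {φ : ℕ → ℕ} (hφ : StrictMono φ) (S : Finset ℕ) :
    stirlingOn (S.image φ) = (stirlingOn S).image (List.map φ) := by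
  ext w
  rw [Finset.mem_image]
  constructor
  · intro hw
    rw [mem_stirlingOn] at hw
    obtain ⟨v, rfl⟩ : w ∈ Set.range (List.map φ) := by
      rw [Set.range_list_map]
      intro i hi
      have : i ∈ S.image φ := hw.1 ▸ List.mem_toFinset.2 hi
      obtain ⟨j, -, rfl⟩ := Finset.mem_image.1 this
      exact ⟨j, rfl⟩
    refine ⟨v, mem_stirlingOn.2 ⟨Finset.image_injective hφ.injective ?_,
      (isStirlingPerm_map hφ).1 hw.2⟩, rfl⟩
    rw [← hw.1]; ext; simp
  · rintro ⟨v, hv, rfl⟩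
    rw [mem_stirlingOn] at hv ⊢
    refine ⟨?_, (isStirlingPerm_map hφ).2 hv.2⟩
    rw [← hv.1]; ext; simp

/-- The increasing enumeration of `T` from index 1, extended to all of `ℕ` so that the relabelling
lemmas apply. The normalisation `φ 0 = 0` serves the induction: it gives `φ T.card < a` when `T` is
empty. -/
theorem exists_strictMono_image (T : Finset ℕ) (h0 : 0 ∉ T) :
    ∃ φ : ℕ → ℕ, StrictMono φ ∧ φ 0 = 0 ∧ (Finset.Icc 1 T.card).image φ = T := by
  induction T using Finset.induction_on_max with
  | empty => exact ⟨id, strictMono_id, rfl, by simp⟩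
  | insert a T ha ih =>
    have haT : a ∉ T := fun h => (ha a h).false
    obtain ⟨φ, hφ, hz, him⟩ := ih fun h => h0 (Finset.mem_insert_of_mem h)
    have hlt : φ T.card < a := by
      rcases Nat.eq_zero_or_pos T.card with hc | hc
      · rw [hc, hz]
        exact Nat.pos_of_ne_zero fun e => h0 (by simp [e])
      · have := Finset.mem_image_of_mem φ (Finset.mem_Icc.2 ⟨hc, le_rfl⟩)
        rw [him] at this
        exact ha _ this
    -- The new maximum `a` is the value at `T.card + 1`; beyond it the map is a translation.
    refine ⟨fun i => if i ≤ T.card then φ i else a + (i - T.card - 1), ?_, by simp [hz], ?_⟩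
    · refine strictMono_nat_of_lt_succ fun i => ?_
      have := hφ (Nat.lt_succ_self i)
      split_ifs with h1 h2 h2
      · exact this
      · obtain rfl : i = T.card := by omega
        omega
      · omega
      · omega
    · rw [Finset.card_insert_of_notMem haT, ← Finset.insert_Icc_right_eq_Icc_add_one (by omega),
        Finset.image_insert]
      congr 1
      · simp
      · exact (Finset.image_congr fun i hi => by simp [(Finset.mem_Icc.1 hi).2]).trans him

/-! ### Weights of words -/

section Weight
variable {R : Type*} [CommRing R]

open Classical in
/-- The contribution of a word to `gCoeff`. -/
noncomputable def wordWeight (A : ℕ → Set PermPattern) (p : ℕ → PermPattern) (x y : ℕ → R)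
    (σ : List ℕ) : R :=
  if ∀ i, ∀ a ∈ A i, a.levelCount σ (i + 1) = 0 then
    ∏ᶠ i : ℕ, x i ^ (p i).levelCount σ (i + 1) * y i ^ blockCount σ (i + 1) else 0

open Classical in
/-- The contribution of a permutation, given as a word, to `fCoeff`. -/
noncomputable def orderWeight {α : Type*} [LinearOrder α] (A : Set PermPattern) (p : PermPattern)
    (z : R) {n : ℕ} (w : Fin n → α) : R :=
  if ∀ a ∈ A, (a.occurrences w).ncard = 0 then z ^ (p.occurrences w).ncard else 0

theorem gCoeff_eq (A : ℕ → Set PermPattern) (p : ℕ → PermPattern) (n : ℕ) (x y : ℕ → R) :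
    gCoeff A p n x y = ∑ σ ∈ stirlingOn (Finset.Icc 1 n), wordWeight A p x y σ := by
  simp only [gCoeff, stirlingAvoiding, Finset.sum_filter, wordWeight, stirlingPerms_eq]

theorem fCoeff_eq (A : Set PermPattern) (p : PermPattern) (n : ℕ) (z : R) :
    fCoeff A p n z = ∑ π : Equiv.Perm (Fin n), orderWeight A p z π := by
  simp only [fCoeff, orderWeight, PermPattern.count]
  classical
  exact Finset.sum_filter _ _

theorem orderWeight_congr {α β : Type*} [LinearOrder α] [LinearOrder β] (A : Set PermPattern)
    (p : PermPattern) (z : R) {n : ℕ} {w : Fin n → α} {v : Fin n → β}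
    (h : ∀ s t, w s < w t ↔ v s < v t) : orderWeight A p z w = orderWeight A p z v := by
  have : ∀ q : PermPattern, q.occurrences w = q.occurrences v := fun q => by
    simp only [PermPattern.occurrences, PermPattern.Matches, h]
  unfold orderWeight
  classical
  exact if_congr (by simp only [this]) (by rw [this]) rfl

theorem orderWeight_cast {α : Type*} [LinearOrder α] (A : Set PermPattern)
    (p : PermPattern) (z : R) {n m : ℕ} (e : n = m) {w : Fin n → α} {v : Fin m → α}
    (h : ∀ s, w s = v (Fin.cast e s)) : orderWeight A p z w = orderWeight A p z v := by
  subst e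
  exact orderWeight_congr A p z fun s t => by rw [h s, h t]; rfl

theorem wordWeight_map (A : ℕ → Set PermPattern) (p : ℕ → PermPattern) (x y : ℕ → R)
    {φ : ℕ → ℕ} (hφ : StrictMono φ) (σ : List ℕ) :
    wordWeight A p x y (σ.map φ) = wordWeight A p x y σ := by
  unfold wordWeight
  classical
  exact if_congr (by simp only [levelCount_map hφ])
    (by simp only [levelCount_map hφ, blockCount_map hφ]) rfl

theorem levelCount_of_length_lt (p : PermPattern) {σ : List ℕ} {l : ℕ} (h : σ.length < l) :
    p.levelCount σ l = 0 := by
  rw [PermPattern.levelCount, Set.ncard_eq_zero (p.finite_blockOccurrences σ l),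
    Set.eq_empty_iff_forall_notMem]
  intro b hb
  exact absurd (hb.2.1 ⟨0, hb.1⟩).le_length (not_le.2 h)

theorem blockCount_of_length_lt {σ : List ℕ} {l : ℕ} (h : σ.length < l) :
    blockCount σ l = 0 := by
  rw [blockCount, Set.ncard_eq_zero (finite_isLevel σ l), Set.eq_empty_iff_forall_notMem]
  intro b hb
  exact absurd (IsLevel.le_length hb) (not_le.2 h)

theorem finprod_levels (p : ℕ → PermPattern) (x y : ℕ → R) {σ : List ℕ} {N : ℕ}
    (h : σ.length ≤ N) :
    ∏ᶠ i : ℕ, x i ^ (p i).levelCount σ (i + 1) * y i ^ blockCount σ (i + 1) =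
      ∏ i ∈ Finset.range N, x i ^ (p i).levelCount σ (i + 1) * y i ^ blockCount σ (i + 1) := by
  refine finprod_eq_prod_of_mulSupport_subset _ fun i hi => ?_
  by_contra hn
  simp only [Finset.coe_range, Set.mem_Iio, not_lt] at hn
  refine hi ?_
  simp only [levelCount_of_length_lt (p i) (show σ.length < i + 1 by omega),
    blockCount_of_length_lt (show σ.length < i + 1 by omega), pow_zero, mul_one]

theorem prod_map_ite {α : Type*} (L : List α) (P : α → Prop) [DecidablePred P] (f : α → R)
    [Decidable (∀ a ∈ L, P a)] :
    (L.map fun a => if P a then f a else 0).prod =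
      if ∀ a ∈ L, P a then (L.map f).prod else 0 := by
  split_ifs with h
  · congr 1
    exact List.map_congr_left fun a ha => if_pos (h a ha)
  · push Not at h
    obtain ⟨a, ha, hP⟩ := h
    exact List.prod_eq_zero (List.mem_map.2 ⟨a, ha, if_neg hP⟩)

theorem prod_list_prod_comm {α ι : Type*} (L : List α) (s : Finset ι) (f : α → ι → R) :
    (L.map fun a => ∏ i ∈ s, f a i).prod = ∏ i ∈ s, (L.map fun a => f a i).prod := by
  induction L with
  | nil => simp
  | cons a L ih => simp [ih, Finset.prod_mul_distrib]

theorem pow_sum_map {α : Type*} (r : R) (L : List α) (f : α → ℕ) :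
    r ^ (L.map f).sum = (L.map fun a => r ^ f a).prod := by
  induction L with
  | nil => simp
  | cons a L ih => simp [pow_add, ih]

/-- Counts below level 1 add over the blocks, so powers multiply; a sum of counts vanishes only if
every count does, so avoidance is a condition on each interior separately. -/
theorem wordWeight_assemble (A : ℕ → Set PermPattern) (p : ℕ → PermPattern) (x y : ℕ → R)
    {L : List (ℕ × List ℕ)} (h : Separated L) :
    wordWeight A p x y (assemble L) =
      orderWeight (A 0) (p 0) (x 0) (fun m : Fin L.length => (L[m]).1) * y 0 ^ L.length *
        (L.map fun B => wordWeight (shift A) (shift p) (shift x) (shift y) B.2).prod := by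
  classical
  have hcond : (∀ i, ∀ a ∈ A i, a.levelCount (assemble L) (i + 1) = 0) ↔
      (∀ a ∈ A 0, (a.occurrences fun m : Fin L.length => (L[m]).1).ncard = 0) ∧
      ∀ B ∈ L, ∀ i, ∀ a ∈ shift A i, a.levelCount B.2 (i + 1) = 0 := by
    constructor
    · refine fun H => ⟨fun a ha => ?_, fun B hB i a ha => ?_⟩
      · rw [← h.levelCount_one]; exact H 0 a ha
      · have := H (i + 1) a ha
        rw [h.levelCount_add_two, List.sum_eq_zero_iff] at this
        exact this _ (List.mem_map.2 ⟨B, hB, rfl⟩)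
    · rintro ⟨H0, H⟩ i a ha
      cases i with
      | zero => rw [h.levelCount_one]; exact H0 a ha
      | succ i =>
        rw [h.levelCount_add_two, List.sum_eq_zero_iff]
        intro c hc
        obtain ⟨B, hB, rfl⟩ := List.mem_map.1 hc
        exact H B hB i a ha
  have hlen : ∀ B ∈ L, B.2.length ≤ (assemble L).length := fun B hB => by
    obtain ⟨pre, post, e, -⟩ := h.exists_segment hB
    rw [e]; simp; omega
  have hprod : ∏ᶠ i : ℕ, x i ^ (p i).levelCount (assemble L) (i + 1) *
        y i ^ blockCount (assemble L) (i + 1) =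
      x 0 ^ ((p 0).occurrences fun m : Fin L.length => (L[m]).1).ncard * y 0 ^ L.length *
        (L.map fun B => ∏ᶠ i : ℕ, shift x i ^ (shift p i).levelCount B.2 (i + 1) *
          shift y i ^ blockCount B.2 (i + 1)).prod := by
    -- The extra 1 leaves, once the level 1 factor is split off, a range long enough for every
    -- interior.
    rw [finprod_levels p x y (N := (assemble L).length + 1) (by omega), Finset.prod_range_succ',
      mul_comm, zero_add, h.levelCount_one, h.blockCount_one]
    congr 1
    rw [List.map_congr_left fun B hB => finprod_levels (shift p) (shift x) (shift y) (hlen B hB),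
      prod_list_prod_comm]
    refine Finset.prod_congr rfl fun i _ => ?_
    rw [add_assoc, h.levelCount_add_two, h.blockCount_add_two, List.prod_map_mul]
    congr 1
    · exact pow_sum_map _ _ _
    · exact pow_sum_map _ _ _
  unfold wordWeight orderWeight
  rw [prod_map_ite]
  rw [if_congr hcond hprod rfl]
  by_cases h0 : ∀ a ∈ A 0, (a.occurrences fun m : Fin L.length => (L[m]).1).ncard = 0
  · by_cases h1 : ∀ B ∈ L, ∀ i, ∀ a ∈ shift A i, a.levelCount B.2 (i + 1) = 0
    · rw [if_pos ⟨h0, h1⟩, if_pos h0, if_pos h1]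
    · rw [if_neg fun H => h1 H.2, if_neg h1, mul_zero]
  · rw [if_neg fun H => h0 H.1, if_neg h0, zero_mul, zero_mul]

end Weight

/-! ### Ordered set partitions -/

/-- Ordered partitions of `S` into `k` nonempty sets. -/
noncomputable def orderedPartitions (S : Finset ℕ) (k : ℕ) : Finset (Fin k → Finset ℕ) :=
  open Classical in (Fintype.piFinset fun _ : Fin k => S.powerset).filter fun T =>
    (∀ j, (T j).Nonempty) ∧ Pairwise (fun i j => Disjoint (T i) (T j)) ∧
      Finset.univ.biUnion T = S

theorem mem_orderedPartitions {S : Finset ℕ} {k : ℕ} {T : Fin k → Finset ℕ} :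
    T ∈ orderedPartitions S k ↔ (∀ j, (T j).Nonempty) ∧
      Pairwise (fun i j => Disjoint (T i) (T j)) ∧ Finset.univ.biUnion T = S := by
  simp only [orderedPartitions, Finset.mem_filter, Fintype.mem_piFinset, Finset.mem_powerset,
    and_iff_right_iff_imp]
  rintro ⟨-, -, rfl⟩ j
  exact Finset.subset_biUnion_of_mem T (Finset.mem_univ j)

theorem subset_of_mem_orderedPartitions {S : Finset ℕ} {k : ℕ} {T : Fin k → Finset ℕ}
    (hT : T ∈ orderedPartitions S k) (j : Fin k) : T j ⊆ S := by
  rw [← (mem_orderedPartitions.1 hT).2.2]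
  exact Finset.subset_biUnion_of_mem T (Finset.mem_univ j)

theorem le_card_of_mem_orderedPartitions {S : Finset ℕ} {k : ℕ} {T : Fin k → Finset ℕ}
    (hT : T ∈ orderedPartitions S k) : k ≤ S.card := by
  obtain ⟨hne, hd, rfl⟩ := mem_orderedPartitions.1 hT
  rw [Finset.card_biUnion fun i _ j _ hij => hd hij]
  calc k = ∑ _j : Fin k, 1 := by simp
    _ ≤ _ := Finset.sum_le_sum fun j _ => (hne j).card_pos

/-- The block with set of letters `T` and interior `w`. -/
noncomputable def blockOf (T : Finset ℕ) (w : List ℕ) : ℕ × List ℕ := (sInf (T : Set ℕ), w)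

theorem sInf_mem_finset {T : Finset ℕ} (hT : T.Nonempty) : sInf (T : Set ℕ) ∈ T :=
  Nat.sInf_mem (s := (T : Set ℕ)) hT

theorem toFinset_blockOf {T : Finset ℕ} (hT : T.Nonempty) {w : List ℕ}
    (hw : w ∈ stirlingOn (T.erase (sInf (T : Set ℕ)))) :
    (blockWord (blockOf T w)).toFinset = T := by
  have : w.toFinset = _ := (mem_stirlingOn.1 hw).1
  ext i
  rw [List.mem_toFinset, mem_blockWord, blockOf]
  simp only
  rw [← List.mem_toFinset, this, Finset.mem_erase]
  by_cases h : i = sInf (T : Set ℕ)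
  · simp only [h, true_or, true_iff]; exact sInf_mem_finset hT
  · simp [h]

theorem lt_of_mem_stirlingOn_erase {T : Finset ℕ} {w : List ℕ}
    (hw : w ∈ stirlingOn (T.erase (sInf (T : Set ℕ)))) : ∀ j ∈ w, sInf (T : Set ℕ) < j := by
  intro j hj
  rw [← List.mem_toFinset, (mem_stirlingOn.1 hw).1, Finset.mem_erase] at hj
  exact lt_of_le_of_ne (Nat.sInf_le (s := (T : Set ℕ)) hj.2) (Ne.symm hj.1)

theorem isBlockList_ofFn {S : Finset ℕ} {k : ℕ} {T : Fin k → Finset ℕ} {w : Fin k → List ℕ}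
    (hT : T ∈ orderedPartitions S k)
    (hw : ∀ j, w j ∈ stirlingOn ((T j).erase (sInf (T j : Set ℕ)))) :
    IsBlockList (List.ofFn fun j => blockOf (T j) (w j)) := by
  obtain ⟨hne, hd, -⟩ := mem_orderedPartitions.1 hT
  refine ⟨fun B hB => ?_, ?_⟩
  · obtain ⟨j, rfl⟩ := (List.mem_ofFn' _ _).1 hB
    exact ⟨(mem_stirlingOn.1 (hw j)).2, lt_of_mem_stirlingOn_erase (hw j)⟩
  · rw [List.pairwise_ofFn]
    intro i j hij a hi hj
    rw [← List.mem_toFinset, toFinset_blockOf (hne _) (hw _)] at hi hj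
    exact Finset.disjoint_left.1 (hd hij.ne) hi hj

theorem toFinset_assemble_ofFn {S : Finset ℕ} {k : ℕ} {T : Fin k → Finset ℕ}
    {w : Fin k → List ℕ} (hT : T ∈ orderedPartitions S k)
    (hw : ∀ j, w j ∈ stirlingOn ((T j).erase (sInf (T j : Set ℕ)))) :
    (assemble (List.ofFn fun j => blockOf (T j) (w j))).toFinset = S := by
  obtain ⟨hne, -, rfl⟩ := mem_orderedPartitions.1 hT
  ext i
  rw [List.mem_toFinset, mem_assemble, Finset.mem_biUnion]
  constructor
  · rintro ⟨B, hB, hi⟩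
    obtain ⟨j, rfl⟩ := (List.mem_ofFn' _ _).1 hB
    rw [← List.mem_toFinset, toFinset_blockOf (hne _) (hw _)] at hi
    exact ⟨j, Finset.mem_univ _, hi⟩
  · rintro ⟨j, -, hi⟩
    refine ⟨_, (List.mem_ofFn' _ _).2 ⟨j, rfl⟩, ?_⟩
    rwa [← List.mem_toFinset, toFinset_blockOf (hne _) (hw _)]

/-- The outer letter of a block is the minimum of its letter set, so a block list amounts to the
sequence of letter sets together with the interiors. -/
theorem sum_stirlingOn {M : Type*} [AddCommMonoid M] (S : Finset ℕ) (Φ : List ℕ → M) :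
    ∑ σ ∈ stirlingOn S, Φ σ = ∑ k ∈ Finset.range (S.card + 1), ∑ T ∈ orderedPartitions S k,
      ∑ w ∈ Fintype.piFinset fun j => stirlingOn ((T j).erase (sInf (T j : Set ℕ))),
        Φ (assemble (List.ofFn fun j => blockOf (T j) (w j))) := by
  simp only [Finset.sum_sigma' (orderedPartitions S _)]
  rw [Finset.sum_sigma']
  symm
  refine Finset.sum_bij (fun a _ => assemble (List.ofFn fun j => blockOf (a.2.1 j) (a.2.2 j)))
    ?_ ?_ ?_ ?_
  · rintro ⟨k, T, w⟩ ha
    simp only [Finset.mem_sigma, Fintype.mem_piFinset] at ha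
    exact mem_stirlingOn.2 ⟨toFinset_assemble_ofFn ha.2.1 ha.2.2,
      (isBlockList_ofFn ha.2.1 ha.2.2).isStirlingPerm⟩
  · rintro ⟨k, T, w⟩ ha ⟨k', T', w'⟩ ha' e
    simp only [Finset.mem_sigma, Fintype.mem_piFinset] at ha ha'
    have e := assemble_injective (isBlockList_ofFn ha.2.1 ha.2.2).separated
      (isBlockList_ofFn ha'.2.1 ha'.2.2).separated e
    have hk : k = k' := by simpa using congrArg List.length e
    subst hk
    have e := List.ofFn_injective e
    have hw : w = w' := funext fun j => congrArg Prod.snd (congrFun e j)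
    have hT : T = T' := funext fun j => by
      rw [← toFinset_blockOf ((mem_orderedPartitions.1 ha.2.1).1 j) (ha.2.2 j),
        ← toFinset_blockOf ((mem_orderedPartitions.1 ha'.2.1).1 j) (ha'.2.2 j)]
      exact congrArg (fun B => (blockWord B).toFinset) (congrFun e j)
    rw [hw, hT]
  · intro σ hσ
    obtain ⟨hS, hσ⟩ := mem_stirlingOn.1 hσ
    obtain ⟨L, hL, rfl⟩ := hσ.exists_isBlockList
    let T : Fin L.length → Finset ℕ := fun j => (blockWord L[j]).toFinset
    have hmin : ∀ j, sInf (T j : Set ℕ) = L[j].1 := fun j => by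
      refine le_antisymm (Nat.sInf_le (by simp [T, mem_blockWord])) ?_
      refine le_csInf ⟨L[j].1, by simp [T, mem_blockWord]⟩ fun i hi => ?_
      rcases mem_blockWord.1 (List.mem_toFinset.1 hi) with e | h
      · exact e.ge
      · exact ((hL.1 _ (List.getElem_mem j.2)).2 i h).le
    have hTS : T ∈ orderedPartitions S L.length := by
      refine mem_orderedPartitions.2 ⟨fun j => ⟨L[j].1, by simp [T, mem_blockWord]⟩,
        fun i j hij => Finset.disjoint_left.2 fun a ha ha' => hij ?_, ?_⟩
      · exact Fin.ext (hL.separated.index_eq i.2 j.2 (List.mem_toFinset.1 ha)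
          (List.mem_toFinset.1 ha'))
      · rw [← hS]
        ext i
        simp only [T, Finset.mem_biUnion, List.mem_toFinset, Finset.mem_univ, true_and,
          mem_assemble]
        constructor
        · rintro ⟨j, hj⟩
          exact ⟨_, List.getElem_mem j.2, hj⟩
        · rintro ⟨B, hB, hi⟩
          obtain ⟨m, hm, rfl⟩ := List.getElem_of_mem hB
          exact ⟨⟨m, hm⟩, hi⟩
    refine ⟨⟨L.length, T, fun j => L[j].2⟩, ?_, ?_⟩
    · simp only [Finset.mem_sigma, Fintype.mem_piFinset, Finset.mem_range]
      refine ⟨Nat.lt_succ_of_le (le_card_of_mem_orderedPartitions hTS), hTS, fun j => ?_⟩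
      obtain ⟨h1, h2⟩ := hL.1 _ (List.getElem_mem j.2)
      rw [mem_stirlingOn, hmin]
      refine ⟨?_, h1⟩
      ext i
      simp only [T, Finset.mem_erase, List.mem_toFinset, mem_blockWord]
      constructor
      · intro hi
        exact ⟨(h2 i hi).ne', Or.inr hi⟩
      · rintro ⟨hne, h | h⟩
        · exact absurd h hne
        · exact h
    · simp only [blockOf, hmin]
      congr 1
      exact List.ofFn_getElem
  · rintro ⟨k, T, w⟩ ha
    rfl


/-! ### Sums over integer partitions -/

section Partition
variable {R : Type*} [CommRing R] [Algebra ℚ R]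

/-- The multisets of parts of the partitions of `n` into `k` parts. -/
noncomputable def partitionParts (n k : ℕ) : Finset (Multiset ℕ) :=
  ((Finset.univ : Finset n.Partition).filter fun lam => lam.parts.card = k).image
    Nat.Partition.parts

theorem mem_partitionParts {n k : ℕ} {m : Multiset ℕ} :
    m ∈ partitionParts n k ↔ (∀ i ∈ m, 0 < i) ∧ m.sum = n ∧ m.card = k := by
  simp only [partitionParts, Finset.mem_image, Finset.mem_filter, Finset.mem_univ, true_and]
  constructor
  · rintro ⟨lam, rfl, rfl⟩
    exact ⟨fun i hi => lam.parts_pos hi, lam.parts_sum, rfl⟩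
  · rintro ⟨h1, h2, h3⟩
    exact ⟨⟨m, fun {i} hi => h1 i hi, h2⟩, h3, rfl⟩

/-- The weight `∏ a_i ^ m_i / m_i!` of a multiset in which `i` has multiplicity `m_i`. -/
noncomputable def multisetWeight (a : ℕ → R) (m : Multiset ℕ) : R :=
  (∏ i ∈ m.toFinset, ((m.count i).factorial : ℚ))⁻¹ • (m.map a).prod

theorem prod_factorial_count {m : Multiset ℕ} {s : Finset ℕ} (h : m.toFinset ⊆ s) :
    ∏ i ∈ s, ((m.count i).factorial : ℚ) = ∏ i ∈ m.toFinset, ((m.count i).factorial : ℚ) := by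
  refine (Finset.prod_subset h fun i _ hi => ?_).symm
  rw [Multiset.count_eq_zero.2 (by simpa using hi)]; simp

/-- With `c` the multiplicity of `i` on the left, `c / c! = 1 / (c - 1)!`: marking a copy of `i` and
deleting it. -/
theorem multisetWeight_cons (a : ℕ → R) (i : ℕ) (m : Multiset ℕ) :
    (((i ::ₘ m).count i : ℕ) : ℚ) • multisetWeight a (i ::ₘ m) = a i * multisetWeight a m := by
  have h1 : m.toFinset ⊆ (i ::ₘ m).toFinset := Multiset.toFinset_subset.2 (Multiset.subset_cons _ _)
  have h2 : i ∈ (i ::ₘ m).toFinset := by simp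
  rw [multisetWeight, multisetWeight, ← prod_factorial_count h1, ← Finset.mul_prod_erase _ _ h2,
    ← Finset.mul_prod_erase _ (fun j => ((m.count j).factorial : ℚ)) h2]
  rw [Finset.prod_congr rfl (g := fun j => ((m.count j).factorial : ℚ)) fun j hj => by
    rw [Multiset.count_cons_of_ne (Finset.ne_of_mem_erase hj)]]
  rw [Multiset.count_cons_self, Nat.factorial_succ, Multiset.map_cons, Multiset.prod_cons,
    smul_smul, mul_smul_comm]
  congr 1
  push_cast
  have : ((m.count i : ℚ) + 1) ≠ 0 := by positivity
  field_simp

/-- The sum of `∏ a_i ^ m_i / m_i!` over the partitions of `n` into `k` parts. -/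
noncomputable def partitionSum (a : ℕ → R) (n k : ℕ) : R :=
  ∑ m ∈ partitionParts n k, multisetWeight a m

/-- Mark one of the `k + 1` parts, writing `k + 1` as the sum of the multiplicities, and delete the
marked part `i`. -/
theorem partitionSum_succ (a : ℕ → R) (n k : ℕ) :
    ((k + 1 : ℕ) : ℚ) • partitionSum a n (k + 1) =
      ∑ i ∈ Finset.Icc 1 n, a i * partitionSum a (n - i) k := by
  have h1 : ∀ m ∈ partitionParts n (k + 1),
      ((k + 1 : ℕ) : ℚ) • multisetWeight a m =
        ∑ i ∈ Finset.Icc 1 n, ((m.count i : ℕ) : ℚ) • multisetWeight a m := by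
    intro m hm
    obtain ⟨hpos, hsum, hcard⟩ := mem_partitionParts.1 hm
    rw [← Finset.sum_smul, ← Nat.cast_sum, Multiset.sum_count_eq_card, hcard]
    intro i hi
    exact Finset.mem_Icc.2 ⟨hpos i hi, hsum ▸ Multiset.le_sum_of_mem hi⟩
  rw [partitionSum, Finset.smul_sum, Finset.sum_congr rfl h1, Finset.sum_comm]
  refine Finset.sum_congr rfl fun i hi => ?_
  rw [Finset.mem_Icc] at hi
  -- Multisets without `i` carry the factor 0; on the others, erasing `i` and adding it are inverse.
  rw [partitionSum, Finset.mul_sum,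
    ← Finset.sum_filter_of_ne (p := fun m : Multiset ℕ => i ∈ m) fun m _ hne => by
      by_contra hn
      exact hne (by rw [Multiset.count_eq_zero.2 hn]; simp)]
  refine Finset.sum_nbij' (fun m => m.erase i) (fun m => i ::ₘ m) ?_ ?_ ?_ ?_ ?_
  · intro m hm
    rw [Finset.mem_filter, mem_partitionParts] at hm
    obtain ⟨⟨hpos, hsum, hcard⟩, him⟩ := hm
    obtain ⟨t, rfl⟩ := Multiset.exists_cons_of_mem him
    rw [Multiset.erase_cons_head, mem_partitionParts]
    simp at hpos hsum hcard
    exact ⟨hpos.2, by omega, hcard⟩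
  · intro m hm
    rw [mem_partitionParts] at hm
    rw [Finset.mem_filter, mem_partitionParts]
    refine ⟨⟨?_, ?_, ?_⟩, by simp⟩
    · simp only [Multiset.mem_cons, forall_eq_or_imp]
      exact ⟨hi.1, hm.1⟩
    · rw [Multiset.sum_cons, hm.2.1]; omega
    · rw [Multiset.card_cons, hm.2.2]
  · intro m hm
    exact Multiset.cons_erase (Finset.mem_filter.1 hm).2
  · intro m _
    exact Multiset.erase_cons_head _ _
  · intro m hm
    obtain ⟨t, rfl⟩ := Multiset.exists_cons_of_mem (Finset.mem_filter.1 hm).2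
    rw [multisetWeight_cons, Multiset.erase_cons_head]

theorem partitionSum_zero (a : ℕ → R) (n : ℕ) :
    partitionSum a n 0 = if n = 0 then 1 else 0 := by
  have : partitionParts n 0 = if n = 0 then {0} else ∅ := by
    ext m
    rw [mem_partitionParts, Multiset.card_eq_zero]
    split_ifs with h
    · simp only [h, Finset.mem_singleton]
      exact ⟨fun h => h.2.2, by rintro rfl; simp⟩
    · simp only [Finset.notMem_empty, iff_false]
      rintro ⟨-, h', rfl⟩
      exact h h'.symm
  rw [partitionSum, this]
  split_ifs <;> simp [multisetWeight]

end Partition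

/-! ### Symmetrisation over the order of the blocks -/

section Symmetrise
variable {R : Type*} [CommRing R]

theorem exists_perm_lt_iff {k : ℕ} (b : Fin k → ℕ) (hb : Function.Injective b) :
    ∃ ρ : Equiv.Perm (Fin k), ∀ s t, b s < b t ↔ ρ s < ρ t := by
  let S := Finset.univ.image b
  have hS : S.card = k := by simp [S, Finset.card_image_of_injective _ hb]
  let o := S.orderIsoOfFin hS
  let e : Fin k ≃ S := Equiv.ofBijective (fun j => ⟨b j, by simp [S]⟩)
    ⟨fun i j h => hb (congrArg Subtype.val h), fun ⟨i, hi⟩ => by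
      obtain ⟨j, -, e⟩ := Finset.mem_image.1 hi
      exact ⟨j, Subtype.ext e⟩⟩
  refine ⟨e.trans o.symm.toEquiv, fun s t => ?_⟩
  change _ ↔ o.symm (e s) < o.symm (e t)
  rw [o.symm.lt_iff_lt]
  rfl

/-- If `ρ` standardises `b`, then `ρ * τ` standardises `b ∘ τ`, and it runs over all permutations as
`τ` does. -/
theorem sum_orderWeight_comp (A : Set PermPattern) (p : PermPattern) (z : R) {k : ℕ}
    (b : Fin k → ℕ) (hb : Function.Injective b) :
    ∑ τ : Equiv.Perm (Fin k), orderWeight A p z (fun j => b (τ j)) = fCoeff A p k z := by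
  obtain ⟨ρ, hρ⟩ := exists_perm_lt_iff b hb
  rw [fCoeff_eq, ← Equiv.sum_comp (Equiv.mulLeft ρ) fun π => orderWeight A p z π]
  exact Finset.sum_congr rfl fun τ _ => orderWeight_congr A p z fun s t => hρ _ _

theorem injective_sInf {S : Finset ℕ} {k : ℕ} {T : Fin k → Finset ℕ}
    (hT : T ∈ orderedPartitions S k) : Function.Injective fun j => sInf (T j : Set ℕ) := by
  obtain ⟨hne, hd, -⟩ := mem_orderedPartitions.1 hT
  intro i j hij
  by_contra hne'
  refine Finset.disjoint_left.1 (hd hne') (sInf_mem_finset (hne i)) ?_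
  have := sInf_mem_finset (hne j)
  rwa [← show sInf (T i : Set ℕ) = sInf (T j : Set ℕ) from hij] at this

theorem comp_mem_orderedPartitions {S : Finset ℕ} {k : ℕ} {T : Fin k → Finset ℕ}
    (hT : T ∈ orderedPartitions S k) (τ : Equiv.Perm (Fin k)) :
    (fun j => T (τ j)) ∈ orderedPartitions S k := by
  obtain ⟨hne, hd, rfl⟩ := mem_orderedPartitions.1 hT
  refine mem_orderedPartitions.2 ⟨fun j => hne _, fun i j hij => hd (τ.injective.ne hij), ?_⟩
  ext i
  simp only [Finset.mem_biUnion, Finset.mem_univ, true_and]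
  exact τ.surjective.exists (p := fun j => i ∈ T j) |>.symm

/-- The product is unchanged when the parts are permuted, so summing over all `k!` reorderings
isolates the sum over arrangements of the distinct minima. No division is used, so any commutative
ring will do. -/
theorem sum_orderWeight_mul (A : Set PermPattern) (p : PermPattern) (z : R) (S : Finset ℕ)
    (k : ℕ) (h : ℕ → R) :
    (k.factorial : R) * ∑ T ∈ orderedPartitions S k,
        orderWeight A p z (fun j => sInf (T j : Set ℕ)) * ∏ j, h (T j).card =
      fCoeff A p k z * ∑ T ∈ orderedPartitions S k, ∏ j, h (T j).card := by
  have key : ∀ τ : Equiv.Perm (Fin k), ∑ T ∈ orderedPartitions S k,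
        orderWeight A p z (fun j => sInf (T j : Set ℕ)) * ∏ j, h (T j).card =
      ∑ T ∈ orderedPartitions S k,
        orderWeight A p z (fun j => sInf (T (τ j) : Set ℕ)) * ∏ j, h (T j).card := by
    intro τ
    symm
    refine Finset.sum_nbij' (fun T j => T (τ j)) (fun T j => T (τ.symm j))
      (fun T hT => comp_mem_orderedPartitions hT τ)
      (fun T hT => comp_mem_orderedPartitions hT τ.symm) (by simp) (by simp) fun T _ => ?_
    rw [Equiv.prod_comp τ fun j => h (T j).card]
  have hsum := Finset.sum_congr (s₁ := (Finset.univ : Finset (Equiv.Perm (Fin k)))) rfl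
    fun τ _ => key τ
  rw [Finset.sum_const, Finset.card_univ, Fintype.card_perm, Fintype.card_fin, nsmul_eq_mul,
    Finset.sum_comm] at hsum
  rw [hsum, Finset.mul_sum]
  refine Finset.sum_congr rfl fun T hT => ?_
  rw [← Finset.sum_mul, sum_orderWeight_comp A p z _ (injective_sInf hT)]

end Symmetrise

/-! ### Counting ordered set partitions -/

section Count
variable {R : Type*} [CommRing R]

theorem orderedPartitions_zero (S : Finset ℕ) :
    orderedPartitions S 0 = if S = ∅ then {Fin.elim0} else ∅ := by
  ext T
  rw [mem_orderedPartitions]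
  split_ifs with h
  · simp [h, Subsingleton.elim T Fin.elim0, Pairwise]
  · simp [Ne.symm h]

theorem cons_mem_orderedPartitions {S U : Finset ℕ} {k : ℕ} {T : Fin k → Finset ℕ} :
    (Fin.cons U T : Fin (k + 1) → Finset ℕ) ∈ orderedPartitions S (k + 1) ↔
      (U ⊆ S ∧ U.Nonempty) ∧ T ∈ orderedPartitions (S \ U) k := by
  rw [mem_orderedPartitions, mem_orderedPartitions]
  simp only [Fin.forall_fin_succ, Fin.cons_zero, Fin.cons_succ, Pairwise]
  have hb : Finset.univ.biUnion (Fin.cons U T : Fin (k + 1) → Finset ℕ) =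
      U ∪ Finset.univ.biUnion T := by
    ext i
    simp [Fin.exists_fin_succ]
  rw [hb]
  constructor
  · rintro ⟨⟨hU, hne⟩, ⟨⟨-, hd⟩, hd'⟩, rfl⟩
    refine ⟨⟨Finset.subset_union_left, hU⟩, hne, fun i j hij => ?_, ?_⟩
    · exact (hd' i).2 j fun e => hij (Fin.succ_injective _ e)
    · rw [Finset.union_sdiff_left, eq_comm, Finset.sdiff_eq_self_iff_disjoint, Finset.disjoint_biUnion_left]
      exact fun j _ => (hd j (Fin.succ_ne_zero j).symm).symm
  · rintro ⟨⟨hUS, hU⟩, hne, hd, e⟩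
    have hUT : ∀ j, Disjoint U (T j) := fun j => by
      have : T j ⊆ S \ U := e ▸ Finset.subset_biUnion_of_mem T (Finset.mem_univ j)
      exact Finset.disjoint_of_subset_right this Finset.disjoint_sdiff
    refine ⟨⟨hU, hne⟩, ⟨⟨fun h => absurd rfl h, fun j _ => hUT j⟩,
      fun i => ⟨fun _ => (hUT i).symm, fun j hij => hd fun e => hij (by rw [e])⟩⟩, ?_⟩
    rw [e, Finset.union_sdiff_of_subset hUS]

/-- The sum of `∏ h (|T_j|)` over the ordered partitions of `S` into `k` sets. -/
noncomputable def orderedSum (h : ℕ → R) (S : Finset ℕ) (k : ℕ) : R :=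
  ∑ T ∈ orderedPartitions S k, ∏ j, h (T j).card

theorem orderedSum_succ (h : ℕ → R) (S : Finset ℕ) (k : ℕ) :
    orderedSum h S (k + 1) =
      ∑ U ∈ S.powerset.filter Finset.Nonempty, h U.card * orderedSum h (S \ U) k := by
  simp only [orderedSum, Finset.mul_sum]
  rw [Finset.sum_sigma']
  refine Finset.sum_bij' (fun T _ => ⟨T 0, Fin.tail T⟩) (fun a _ => Fin.cons a.1 a.2)
    ?_ ?_ ?_ ?_ ?_
  · intro T hT
    rw [← Fin.cons_self_tail T, cons_mem_orderedPartitions] at hT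
    simpa using hT
  · rintro ⟨U, T⟩ ha
    rw [cons_mem_orderedPartitions]
    simpa using ha
  · intro T _
    exact Fin.cons_self_tail T
  · rintro ⟨U, T⟩ _
    rfl
  · intro T _
    rw [Fin.prod_univ_succ]; rfl

variable [Algebra ℚ R]

/-- Induction on `k`, splitting off the first part. The number of its choices with size `i`, times
`(|S| - i)!`, is `|S|! / i!`; the factor `k + 1` of `(k + 1)!` is absorbed by `partitionSum_succ`.
-/
theorem orderedSum_eq (h : ℕ → R) (S : Finset ℕ) (k : ℕ) :
    orderedSum h S k = ((S.card.factorial : ℚ) * (k.factorial : ℚ)) •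
      partitionSum (fun i => ((i.factorial : ℚ))⁻¹ • h i) S.card k := by
  induction k generalizing S with
  | zero =>
    rw [partitionSum_zero, orderedSum, orderedPartitions_zero]
    by_cases hS : S = ∅
    · simp [hS]
    · simp [hS]
  | succ k ih =>
    -- The value 0 at 0 encodes nonemptiness of the first part, so the sum extends to all subsets
    -- and can be grouped by size.
    let F : ℕ → R := fun i => if i = 0 then 0 else
      h i * ((((S.card - i).factorial : ℚ) * (k.factorial : ℚ)) •
        partitionSum (fun i => ((i.factorial : ℚ))⁻¹ • h i) (S.card - i) k)
    have e1 : ∀ U ∈ S.powerset.filter Finset.Nonempty, h U.card * orderedSum h (S \ U) k =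
        F U.card := by
      intro U hU
      rw [Finset.mem_filter, Finset.mem_powerset] at hU
      simp only [F]
      rw [if_neg hU.2.card_ne_zero, ih, Finset.card_sdiff_of_subset hU.1]
    rw [orderedSum_succ, Finset.sum_congr rfl e1, Finset.sum_filter_of_ne,
      Finset.sum_powerset_apply_card F, Finset.sum_range_succ', show F 0 = 0 from if_pos rfl,
      smul_zero, add_zero, Nat.factorial_succ, mul_comm (k + 1), Nat.cast_mul, ← mul_assoc,
      mul_smul, partitionSum_succ, Finset.smul_sum, Finset.range_eq_Ico,
      Finset.sum_Ico_add' (fun i => S.card.choose i • F i)]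
    · refine Finset.sum_congr (by ext; simp) fun i hi => ?_
      rw [Finset.mem_Icc] at hi
      rw [show F i = _ from if_neg (by omega), ← Nat.cast_smul_eq_nsmul ℚ, mul_smul_comm, smul_mul_assoc, smul_smul,
        smul_smul, Nat.cast_choose ℚ hi.2]
      congr 1
      field_simp
    · intro U _ hne
      rw [← Finset.card_pos]
      by_contra hc
      exact hne (if_pos (by omega))

end Count

/-! ### The recursion -/

theorem sum_wordWeight_stirlingOn {R : Type*} [CommRing R] (A : ℕ → Set PermPattern)
    (p : ℕ → PermPattern) (x y : ℕ → R) {T : Finset ℕ} (h0 : 0 ∉ T) :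
    ∑ σ ∈ stirlingOn T, wordWeight A p x y σ = gCoeff A p T.card x y := by
  obtain ⟨φ, hφ, -, him⟩ := exists_strictMono_image T h0
  conv_lhs => rw [← him, stirlingOn_image hφ]
  rw [Finset.sum_image fun _ _ _ _ e => hφ.injective.list_map e, gCoeff_eq]
  exact Finset.sum_congr rfl fun σ _ => wordWeight_map A p x y hφ σ

theorem gCoeff_eq_sum_orderedPartitions {R : Type*} [CommRing R] (A : ℕ → Set PermPattern)
    (p : ℕ → PermPattern) (x y : ℕ → R) (n : ℕ) :
    gCoeff A p n x y = ∑ k ∈ Finset.range (n + 1), y 0 ^ k *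
      ∑ T ∈ orderedPartitions (Finset.Icc 1 n) k,
        orderWeight (A 0) (p 0) (x 0) (fun j => sInf (T j : Set ℕ)) *
          ∏ j, gCoeff (shift A) (shift p) ((T j).card - 1) (shift x) (shift y) := by
  rw [gCoeff_eq, sum_stirlingOn, Nat.card_Icc, Nat.add_sub_cancel]
  refine Finset.sum_congr rfl fun k _ => ?_
  rw [Finset.mul_sum]
  refine Finset.sum_congr rfl fun T hT => ?_
  have h1 : ∀ j, gCoeff (shift A) (shift p) ((T j).card - 1) (shift x) (shift y) =
      ∑ w ∈ stirlingOn ((T j).erase (sInf (T j : Set ℕ))),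
        wordWeight (shift A) (shift p) (shift x) (shift y) w := fun j => by
    rw [sum_wordWeight_stirlingOn, Finset.card_erase_of_mem
      (sInf_mem_finset ((mem_orderedPartitions.1 hT).1 j))]
    intro h
    have := subset_of_mem_orderedPartitions hT j (Finset.mem_of_mem_erase h)
    simp at this
  rw [Finset.prod_congr rfl fun j _ => h1 j, Finset.prod_univ_sum, Finset.mul_sum, Finset.mul_sum]
  refine Finset.sum_congr rfl fun w hw => ?_
  rw [Fintype.mem_piFinset] at hw
  rw [wordWeight_assemble A p x y (isBlockList_ofFn hT hw).separated,
    orderWeight_cast (A 0) (p 0) (x 0) (List.length_ofFn)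
      (v := fun j => sInf (T j : Set ℕ)) (fun s => by
        rw [Fin.getElem_fin, List.getElem_ofFn]; rfl),
    List.length_ofFn, List.map_ofFn, List.prod_ofFn]
  simp only [Function.comp_apply, blockOf]
  ring

/-- The `k!` of the symmetrisation cancels the `k!` counting orders of the parts; this is where
division in the `ℚ`-algebra enters. -/
theorem gCoeff_eq_sum_partitionSum {R : Type*} [CommRing R] [Algebra ℚ R]
    (A : ℕ → Set PermPattern) (p : ℕ → PermPattern) (x y : ℕ → R) (n : ℕ) :
    gCoeff A p n x y = ∑ k ∈ Finset.range (n + 1), (n.factorial : ℚ) •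
      (y 0 ^ k * fCoeff (A 0) (p 0) k (x 0) * partitionSum (fun i => ((i.factorial : ℚ))⁻¹ •
        gCoeff (shift A) (shift p) (i - 1) (shift x) (shift y)) n k) := by
  rw [gCoeff_eq_sum_orderedPartitions]
  refine Finset.sum_congr rfl fun k _ => ?_
  have h1 := sum_orderWeight_mul (A 0) (p 0) (x 0) (Finset.Icc 1 n) k
    (fun i => gCoeff (shift A) (shift p) (i - 1) (shift x) (shift y))
  have h2 := orderedSum_eq (fun i => gCoeff (shift A) (shift p) (i - 1) (shift x) (shift y))
    (Finset.Icc 1 n) k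
  rw [orderedSum, Nat.card_Icc, Nat.add_sub_cancel] at h2
  rw [h2, mul_comm (n.factorial : ℚ), mul_smul, mul_smul_comm, ← nsmul_eq_mul,
    ← Nat.cast_smul_eq_nsmul ℚ] at h1
  have hk : (k.factorial : ℚ) ≠ 0 := by positivity
  have h3 := congrArg (fun r => (k.factorial : ℚ)⁻¹ • r) h1
  simp only [inv_smul_smul₀ hk] at h3
  rw [h3, mul_smul_comm, mul_smul_comm, mul_assoc]

end BlockPattern

theorem corollary2 {R : Type*} [CommRing R] [Algebra ℚ R]
    (A : ℕ → Set BlockPattern.PermPattern) (p : ℕ → BlockPattern.PermPattern)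
    (x y : ℕ → R) (n : ℕ) :
    BlockPattern.gCoeff A p n x y =
      ∑ lam : n.Partition,
        (((n.factorial : ℚ) / (lam.parts.map (fun k => (k.factorial : ℚ))).prod) /
            (∏ i ∈ Finset.Icc 1 n, ((lam.parts.count i).factorial : ℚ))) •
          (y 0 ^ lam.parts.card *
            BlockPattern.fCoeff (A 0) (p 0) lam.parts.card (x 0) *
            (lam.parts.map (fun k =>
              BlockPattern.gCoeff (BlockPattern.shift A) (BlockPattern.shift p) (k - 1)
                (BlockPattern.shift x) (BlockPattern.shift y))).prod) := by
  have hcard : ∀ lam : n.Partition, lam.parts.card ≤ n := fun lam => by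
    have := Multiset.card_nsmul_le_sum (s := lam.parts) (a := 1) fun i hi => lam.parts_pos hi
    rwa [lam.parts_sum, smul_eq_mul, mul_one] at this
  rw [BlockPattern.gCoeff_eq_sum_partitionSum, ← Finset.sum_fiberwise_of_maps_to
    (s := (Finset.univ : Finset n.Partition)) (t := Finset.range (n + 1))
    (g := fun lam => lam.parts.card) fun lam _ => Finset.mem_range_succ_iff.2 (hcard lam)]
  refine Finset.sum_congr rfl fun k _ => ?_
  rw [BlockPattern.partitionSum, BlockPattern.partitionParts,
    Finset.sum_image fun _ _ _ _ e => Nat.Partition.ext e, Finset.mul_sum, Finset.smul_sum]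
  refine Finset.sum_congr rfl fun lam hlam => ?_
  obtain rfl : lam.parts.card = k := (Finset.mem_filter.1 hlam).2
  have hsub : lam.parts.toFinset ⊆ Finset.Icc 1 n := fun i hi => by
    rw [Multiset.mem_toFinset] at hi
    exact Finset.mem_Icc.2 ⟨lam.parts_pos hi, lam.parts_sum ▸ Multiset.le_sum_of_mem hi⟩
  have hprod : ∀ (m : Multiset ℕ) (g : ℕ → R),
      (m.map fun i => ((i.factorial : ℚ))⁻¹ • g i).prod =
        ((m.map fun i => (i.factorial : ℚ)).prod)⁻¹ • (m.map g).prod := fun m g => by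
    induction m using Multiset.induction_on with
    | empty => simp
    | cons a m ih =>
      simp only [Multiset.map_cons, Multiset.prod_cons, ih, smul_mul_smul_comm, mul_inv]
  -- Sizes in `Icc 1 n` that are not parts contribute `0! = 1`.
  rw [BlockPattern.multisetWeight, ← BlockPattern.prod_factorial_count hsub, hprod, smul_smul,
    mul_smul_comm, smul_smul]
  congr 1
  rw [div_eq_mul_inv, div_eq_mul_inv]
  ring
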